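/- **Setting.** Let $d,N\ge 1$. Let $k:\mathbb{R}^d\times\mathbb{R}^d\to\mathbb{R}$ be a symmetric positive-definite $C^2$ kernel (positive-definite in the usual sense $\sum_{i,j}c_ic_jk(x_i,x_j)\ge 0$) and let $V:\mathbb{R}^d\to\mathbb{R}$ be $C^2$ with $\int e^{-V}<\infty$; let $\pi$ be the probability measure with density proportional to $e^{-V}$. For a step size $\eta>0$, SVGD started from $\underline{x}(0)\in(\mathbb{R}^d)^N$ is $$x_i(n+1)=x_i(n)-\frac{\eta}{N}\sum_{j=1}^N\bigl[k(x_i(n),x_j(n))\nabla V(x_j(n))-\nabla_2k(x_i(n),x_j(n))\bigr],\qquad 1\le i\le N,\ n\ge 0,$$ where $\nabla_2$ is the gradient in the second argument, and $\mu_n^N=\frac1N\sum_i\delta_{x_i(n)}$. Let $\mathcal H_0$ be the reproducing kernel Hilbert space of $k$ and $\mathcal H=\mathcal H_0\times\dots\times\mathcal H_0$ ($d$ factors) with $\|\phi\|_{\mathcal H}^2=\sum_l\|\phi_l\|_{\mathcal H_0}^2$. The kernelized Stein discrepancy is $$\mathsf{KSD}(P\|\pi)=\sup\Bigl\{\mathbb{E}_{X\sim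 P}\bigl[-\nabla V(X)\cdot\phi(X)+\nabla\cdot\phi(X)\bigr]:\ \phi\in\mathcal H,\ \|\phi\|_{\mathcal H}\le 1\Bigr\}.$$ Let $\mathsf{KL}$ be the relative entropy and let $p(0)$ be a probability law on $(\mathbb{R}^d)^N$. **Assumptions.** For constants $B,A,c^*,C_{KL}>0$, $C_V<\infty$ and $\alpha\in[0,1/2]$: (a) $k$ and all its partial derivatives up to order $2$ are bounded by $B$ in absolute value; (b) $\inf V>0$ and $\|\nabla V(x)\|\le A\,V(x)^\alpha$ for all $x$; (c) $\sup_z\|H_V(z)\|_{op}\le C_V$, where $H_V$ is the Hessian of $V$; (d) $\sup_z\bigl[\nabla_2k(z,z)\cdot\nabla V(z)+k(z,z)\Delta V(z)-\Delta_2k(z,z)\bigr]\le c^*d$, where $\nabla_2k(z,z)$ and $\Delta_2 k(z,z)$ are the gradient and the Laplacian of $k(z,\cdot)$ at $z$; (e) $\mathsf{KL}(p(0)\|\pi^{\otimes N})\le C_{KL}Nd$ (in particular $p(0)$ has a density). **Theorem 3.1.** There exist constants $a,b>0$ depending only on $A,B,\alpha,C_V,c^*,C_{KL}$ (not on $d,N,k,V,p(0)$,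 nor on the number $K$ below) such that the following holds. Let $K>0$ be such that $\mathcal S_K=\{\underline{x}\in(\mathbb{R}^d)^N: N^{-1}\sum_iV(x_i)\le K\}$ has $p(0)$-probability at least $1/2$, and let $p_K(0)$ be $p(0)$ conditioned on $\mathcal S_K$. With $$\eta=\frac{a}{d^{\frac{1+\alpha}{2(1-\alpha)}}+\sqrt d\,K^\alpha+d}\,N^{-\frac{1+\alpha}{1-\alpha}},\qquad T=\bigl\lceil N^{\frac{2}{1-\alpha}}\bigr\rceil,$$ if $\underline{x}(0)\sim p_K(0)$, then $$\mathbb{E}\Bigl[\frac1T\sum_{n=0}^{T-1}\mathsf{KSD}^2(\mu_n^N\|\pi)\Bigr]\le\frac{b\,d\,\bigl(d^{\frac{1+\alpha}{2(1-\alpha)}}+\sqrt d\,K^\alpha+d\bigr)}{N};$$ and if instead $\underline{x}(0)\sim p(0)$, then, with the same $\eta$ and $T$, for every $\epsilon>0$, $$\mathbb{P}\Bigl(\frac1T\sum_{n=0}^{T-1}\mathsf{KSD}^2(\mu_n^N\|\pi)>\frac{b\,d\,\bigl(d^{\frac{1+\alpha}{2(1-\alpha)}}+\sqrt d\,K^\alpha+d\bigr)}{N\epsilon}\Bigr)\le\epsilon+\mathbb{P}\bigl(\underline{x}(0)\notin\mathcal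 S_K\bigr).$$ -/

import Mathlib

open MeasureTheory ProbabilityTheory
open scoped ENNReal

noncomputable section

namespace SVGD

/-- The state space `ℝ^d` with its Euclidean norm. -/
abbrev E (d : ℕ) : Type := EuclideanSpace ℝ (Fin d)

/-- The probability measure `π ∝ exp (-V)`. -/
def target {d : ℕ} (V : E d → ℝ) : Measure (E d) :=
  volume.tilted fun x => -V x

/-- The Hessian of `V` at `z`, as a linear operator on `ℝ^d`. -/
def hessian {d : ℕ} (V : E d → ℝ) (z : E d) : E d →L[ℝ] E d :=
  fderiv ℝ (gradient V) z

/-- The coordinate directions of `ℝ^d × ℝ^d`. -/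
def coordDir (d : ℕ) : Fin d ⊕ Fin d → E d × E d :=
  Sum.elim (fun i => (EuclideanSpace.single i 1, 0)) (fun i => (0, EuclideanSpace.single i 1))

/-- The kernel and all of its partial derivatives of order one and two (including the mixed ones)
are bounded by `B` in absolute value. -/
def KernelBoundedBy {d : ℕ} (k : E d → E d → ℝ) (B : ℝ) : Prop :=
  ∀ p : E d × E d,
    |k p.1 p.2| ≤ B ∧
    (∀ i, |fderiv ℝ (fun q : E d × E d => k q.1 q.2) p (coordDir d i)| ≤ B) ∧
    ∀ i j, |fderiv ℝ (fun r => fderiv ℝ (fun q : E d × E d => k q.1 q.2) r (coordDir d i)) p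
      (coordDir d j)| ≤ B

/-- `C^*(z) = ∇₂k(z,z) · ∇V(z) + k(z,z) ΔV(z) - Δ₂k(z,z)`. -/
def Cstar {d : ℕ} (k : E d → E d → ℝ) (V : E d → ℝ) (z : E d) : ℝ :=
  inner ℝ (gradient (k z) z) (gradient V z) + k z z * Laplacian.laplacian V z
    - Laplacian.laplacian (k z) z

/-- The scalar kernel `k` with its values read as operators `ℝ → ℝ`. -/
def opKernel {d : ℕ} (k : E d → E d → ℝ) : Matrix (E d) (E d) (ℝ →L[ℝ] ℝ) :=
  Matrix.of fun x y => k x y • ContinuousLinearMap.id ℝ ℝ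

theorem opKernel_posSemidef {d : ℕ} {k : E d → E d → ℝ} (hk : (Matrix.of k).PosSemidef) :
    (opKernel k).PosSemidef := by
  have key := (RKHS.posSemidef_tfae (K := opKernel k)).out 0 2
  refine key.mpr ⟨?_, fun v => ?_⟩
  · ext x y
    have h := hk.1.apply x y
    simp only [Matrix.of_apply, star_trivial] at h
    have h1 : star (ContinuousLinearMap.id ℝ ℝ) = ContinuousLinearMap.id ℝ ℝ :=
      star_one (ℝ →L[ℝ] ℝ)
    simp [opKernel, h, h1]
  · have h := hk.2 v
    simp only [Matrix.of_apply, star_trivial] at h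
    simp only [opKernel, Matrix.of_apply, RCLike.re_to_real]
    refine h.trans_eq (Finsupp.sum_congr fun x _ => Finsupp.sum_congr fun y _ => ?_)
    have h' := hk.1.apply x y
    simp only [Matrix.of_apply, star_trivial] at h'
    simp [h']
    ring

/-- The reproducing kernel Hilbert space `H₀` of real-valued functions with kernel `k`. -/
def H0 {d : ℕ} (k : E d → E d → ℝ) (hk : (Matrix.of k).PosSemidef) : Type :=
  haveI : Fact (opKernel k).PosSemidef := ⟨opKernel_posSemidef hk⟩
  RKHS.OfKernel (opKernel k)

section

variable {d : ℕ} (k : E d → E d → ℝ) (hk : (Matrix.of k).PosSemidef)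

instance : NormedAddCommGroup (H0 k hk) :=
  haveI : Fact (opKernel k).PosSemidef := ⟨opKernel_posSemidef hk⟩
  inferInstanceAs (NormedAddCommGroup (RKHS.OfKernel (opKernel k)))

instance : InnerProductSpace ℝ (H0 k hk) :=
  haveI : Fact (opKernel k).PosSemidef := ⟨opKernel_posSemidef hk⟩
  inferInstanceAs (InnerProductSpace ℝ (RKHS.OfKernel (opKernel k)))

instance : CompleteSpace (H0 k hk) :=
  haveI : Fact (opKernel k).PosSemidef := ⟨opKernel_posSemidef hk⟩
  inferInstanceAs (CompleteSpace (RKHS.OfKernel (opKernel k)))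

instance : RKHS ℝ (H0 k hk) (E d) ℝ :=
  haveI : Fact (opKernel k).PosSemidef := ⟨opKernel_posSemidef hk⟩
  inferInstanceAs (RKHS ℝ (RKHS.OfKernel (opKernel k)) (E d) ℝ)

/-- `k` is the reproducing kernel of `H0 k hk`. -/
theorem kernel_H0 : RKHS.kernel (H0 k hk) = opKernel k :=
  haveI : Fact (opKernel k).PosSemidef := ⟨opKernel_posSemidef hk⟩
  RKHS.OfKernel.kernel_ofKernel (K := opKernel k)

end

/-- The product `H = H₀ × ⋯ × H₀` (`d` factors), with `‖φ‖² = ∑ l, ‖φ l‖²`. -/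
abbrev H {d : ℕ} (k : E d → E d → ℝ) (hk : (Matrix.of k).PosSemidef) : Type :=
  PiLp 2 fun _ : Fin d => H0 k hk

/-- An element of `H` as a vector field on `ℝ^d`. -/
def field {d : ℕ} {k : E d → E d → ℝ} {hk : (Matrix.of k).PosSemidef} (φ : H k hk) (x : E d) :
    E d :=
  WithLp.toLp 2 fun l => φ l x

/-- The Langevin–Stein operator `-∇V · φ + div φ`. -/
def stein {d : ℕ} (V : E d → ℝ) (φ : E d → E d) (x : E d) : ℝ :=
  -inner ℝ (gradient V x) (φ x) + ∑ l, fderiv ℝ φ x (EuclideanSpace.single l 1) l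

/-- The kernelized Stein discrepancy of `P` with respect to `π ∝ exp (-V)`: the supremum of
`E[(stein V φ) X]`, `X ∼ P`, over the unit ball of `H`. As the ball is symmetric, the supremum
is nonnegative and the negative values of the expectation may be replaced by zero; the supremum is
taken in `[0, ∞]`. -/
def KSD {d : ℕ} (k : E d → E d → ℝ) (hk : (Matrix.of k).PosSemidef) (V : E d → ℝ)
    (P : Measure (E d)) : ℝ≥0∞ :=
  ⨆ (φ : H k hk) (_ : ‖φ‖ ≤ 1), ENNReal.ofReal (∫ x, stein V (field φ) x ∂P)

/-- The empirical measure of the points `x 0, …, x (N - 1)`. -/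
def empirical {d N : ℕ} (x : Fin N → E d) : Measure (E d) :=
  (N : ℝ≥0∞)⁻¹ • ∑ i, Measure.dirac (x i)

/-- One SVGD iteration with step size `η`. -/
def step {d N : ℕ} (k : E d → E d → ℝ) (V : E d → ℝ) (η : ℝ) (x : Fin N → E d) : Fin N → E d :=
  fun i => x i - (η / N) • ∑ j, (k (x i) (x j) • gradient V (x j) - gradient (k (x i)) (x j))

/-- `T⁻¹ ∑_{n < T} KSD² (μ_n ‖ π)`, where `μ_n` is the empirical measure after `n` SVGD iterations
with step size `η` from the initial points `x`. -/
def avgKSDSq {d N : ℕ} (k : E d → E d → ℝ) (hk : (Matrix.of k).PosSemidef) (V : E d → ℝ)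
    (η : ℝ) (T : ℕ) (x : Fin N → E d) : ℝ≥0∞ :=
  (T : ℝ≥0∞)⁻¹ * ∑ n ∈ Finset.range T, KSD k hk V (empirical ((step k V η)^[n] x)) ^ 2

/-- The set `S_K` of configurations with `N⁻¹ ∑ V (x i) ≤ K`. -/
def sublevel {d : ℕ} (N : ℕ) (V : E d → ℝ) (K : ℝ) : Set (Fin N → E d) :=
  {x | (N : ℝ)⁻¹ * ∑ i, V (x i) ≤ K}

/-- `d^{(1+α)/(2(1-α))} + √d K^α + d`. -/
def dimFactor (d : ℕ) (α K : ℝ) : ℝ :=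
  (d : ℝ) ^ ((1 + α) / (2 * (1 - α))) + √(d : ℝ) * K ^ α + d

end SVGD

end

/-! Let `F` be one SVGD step on `(ℝ^d)^N` and `W x = ∑ V (x i)`. Relative to `π^{⊗N}`, the function
`exp (W - W ∘ F^T) |det DF^T|` is the density of the pullback of `π^{⊗N}` under `F^T`, so its
integral over a set on which `F^T` is injective is at most one
(`setLIntegral_exp_mul_abs_det_le_one`). The entropy inequality `∫ u dp ≤ KL + c + ∫ exp (u - c) dν`
(`setLIntegral_le_klDiv_add`), applied once at time zero, then bounds the mean of any `u` for which
`u - c` lies below the logarithm of that density. The laws of `x(n)`, `n > 0`, are never needed.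

The pathwise bound is `ksdSq_le_log_jacobian`. To first order in `η`, `W - W ∘ F + log |det DF|` is
`η (∑ ∇V · drift - div drift)`. Expanding the divergence produces the Stein kernel, and the diagonal
terms `j = i` add `C^*`: the result is `η (N · KSD² - average of C^*)`
(`inner_gradient_drift_sub_trace`). The second order errors come from a Taylor bound for `V` and
from `-log |det (1 - M)| ≤ tr M + 4 ‖M‖²` in Hilbert–Schmidt norm. Summing over `T` steps
telescopes; dividing by `η N T` gives the rate `1 / N`.

The errors require `∇V` to be controlled along the trajectory. As `k` is positive definite, the part
`k ∇V` of the drift decreases `W` to first order, so while the average potential is at most `M` its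
first order growth is at most of order `η √d M^α` per step. With `M = K + N^{1/(1-α)}` the chosen
`η` keeps it below `M` for all `T` steps; the same control makes every step injective along the
trajectory. Finally, the Stein functional is represented in the RKHS, which bounds `KSD²` of an
empirical measure by the double sum `ksdSq` (`KSD_empirical_sq_le`). -/

namespace SVGD

/-! ### Passing between coordinatewise bounds and Euclidean norms. -/

section Coordinates

variable {d : ℕ}

theorem norm_le_sqrt_mul {c : ℝ} (hc : 0 ≤ c) (w : E d) (h : ∀ l, |w l| ≤ c) :
    ‖w‖ ≤ √(d : ℝ) * c := by
  rw [EuclideanSpace.norm_eq]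
  refine Real.sqrt_le_iff.mpr ⟨by positivity, ?_⟩
  calc ∑ l, ‖w l‖ ^ 2 ≤ ∑ _l : Fin d, c ^ 2 :=
        Finset.sum_le_sum fun l _ => pow_le_pow_left₀ (norm_nonneg _) (h l) 2
    _ = (√(d : ℝ) * c) ^ 2 := by
        rw [mul_pow, Real.sq_sqrt (Nat.cast_nonneg d)]; simp

theorem sum_abs_le_sqrt_mul_norm (u : E d) : ∑ l, |u l| ≤ √(d : ℝ) * ‖u‖ := by
  rw [EuclideanSpace.norm_eq, ← Real.sqrt_mul (Nat.cast_nonneg d)]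
  refine Real.le_sqrt_of_sq_le ?_
  have h := sq_sum_le_card_mul_sum_sq (s := Finset.univ) (f := fun l => |u l|)
  simpa using h

theorem sum_smul_single (u : E d) : ∑ l, u l • EuclideanSpace.single l (1 : ℝ) = u := by
  ext m
  simp [Finset.sum_apply, Pi.single_apply]

/-- Each factor is expanded in coordinates; the `√d` is the ratio of the `ℓ¹` and `ℓ²` norms. -/
theorem abs_apply_le_of_coordDir {L : E d × E d →L[ℝ] ℝ} {c : ℝ}
    (h : ∀ i, |L (coordDir d i)| ≤ c) (u v : E d) :
    |L (u, v)| ≤ c * √(d : ℝ) * (‖u‖ + ‖v‖) := by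
  have aux : ∀ (R : E d →L[ℝ] ℝ), (∀ l, |R (EuclideanSpace.single l 1)| ≤ c) → ∀ u,
      |R u| ≤ c * √(d : ℝ) * ‖u‖ := by
    intro R hR u
    rcases isEmpty_or_nonempty (Fin d) with h0 | h0
    · have : u = 0 := Subsingleton.elim _ _
      simp [this]
    have hc : 0 ≤ c := (abs_nonneg _).trans (hR h0.some)
    conv_lhs => rw [← sum_smul_single u]
    rw [map_sum]
    calc |∑ l, R (u l • EuclideanSpace.single l 1)| ≤ ∑ l, |u l| * c := by
          refine (Finset.abs_sum_le_sum_abs _ _).trans (Finset.sum_le_sum fun l _ => ?_)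
          rw [map_smul, smul_eq_mul, abs_mul]
          exact mul_le_mul_of_nonneg_left (hR l) (abs_nonneg _)
      _ = c * ∑ l, |u l| := by rw [← Finset.sum_mul, mul_comm]
      _ ≤ c * (√(d : ℝ) * ‖u‖) := mul_le_mul_of_nonneg_left (sum_abs_le_sqrt_mul_norm u) hc
      _ = _ := by ring
  have h1 := aux (L ∘L ContinuousLinearMap.inl ℝ _ _) (fun l => by simpa [coordDir] using h (.inl l)) u
  have h2 := aux (L ∘L ContinuousLinearMap.inr ℝ _ _) (fun l => by simpa [coordDir] using h (.inr l)) v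
  have h3 : L (u, v) = (L ∘L ContinuousLinearMap.inl ℝ _ _) u
      + (L ∘L ContinuousLinearMap.inr ℝ _ _) v := by
    simp [← map_add]
  rw [h3, mul_add]
  exact (abs_add_le _ _).trans (add_le_add h1 h2)

end Coordinates

/-! ### Derivatives of the kernel and their dimension-dependent bounds. -/

section Kernel

variable {d : ℕ} (k : E d → E d → ℝ)

/-- The derivative of the kernel as a function on the product space. -/
noncomputable def kerD (p : E d × E d) : E d × E d →L[ℝ] ℝ :=
  fderiv ℝ (fun q : E d × E d => k q.1 q.2) p

/-- The second derivative of the kernel as a function on the product space. -/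
noncomputable def kerD2 (p : E d × E d) : E d × E d →L[ℝ] E d × E d →L[ℝ] ℝ :=
  fderiv ℝ (kerD k) p

/-- The gradient of the kernel in its second argument, as a function on the product space. -/
noncomputable def grad₂ (p : E d × E d) : E d := gradient (k p.1) p.2

variable {k}

section Smooth

variable (hk : ContDiff ℝ 2 fun p : E d × E d => k p.1 p.2)
include hk

theorem hasFDerivAt_kernel (p : E d × E d) :
    HasFDerivAt (fun q : E d × E d => k q.1 q.2) (kerD k p) p :=
  (hk.differentiable (by norm_num) p).hasFDerivAt

theorem contDiff_kerD : ContDiff ℝ 1 (kerD k) :=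
  hk.fderiv_right (by norm_num)

theorem hasFDerivAt_kerD (p : E d × E d) : HasFDerivAt (kerD k) (kerD2 k p) p :=
  ((contDiff_kerD hk).differentiable (by norm_num) p).hasFDerivAt

theorem continuous_kerD2 : Continuous (kerD2 k) :=
  (contDiff_kerD hk).continuous_fderiv (by norm_num)

theorem hasFDerivAt_kernel_right (x y : E d) :
    HasFDerivAt (k x) (kerD k (x, y) ∘L ContinuousLinearMap.inr ℝ (E d) (E d)) y :=
  HasFDerivAt.comp (f := fun y : E d => (x, y)) (g := fun q : E d × E d => k q.1 q.2) y
    (hasFDerivAt_kernel hk (x, y)) (hasFDerivAt_prodMk_right x y)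

theorem hasFDerivAt_kernel_left (x y : E d) :
    HasFDerivAt (fun z => k z y) (kerD k (x, y) ∘L ContinuousLinearMap.inl ℝ (E d) (E d)) x :=
  HasFDerivAt.comp (f := fun z : E d => (z, y)) (g := fun q : E d × E d => k q.1 q.2) x
    (hasFDerivAt_kernel hk (x, y)) (hasFDerivAt_prodMk_left x y)

theorem inner_grad₂ (p : E d × E d) (w : E d) : inner ℝ (grad₂ k p) w = kerD k p (0, w) := by
  rw [grad₂, inner_gradient_left, (hasFDerivAt_kernel_right hk p.1 p.2).fderiv]
  simp

theorem grad₂_eq : grad₂ k = fun p => (InnerProductSpace.toDual ℝ (E d)).symm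
    (kerD k p ∘L ContinuousLinearMap.inr ℝ (E d) (E d)) := by
  funext p
  refine ext_inner_right ℝ fun w => ?_
  rw [inner_grad₂ hk, InnerProductSpace.toDual_symm_apply]
  simp

theorem contDiff_grad₂ : ContDiff ℝ 1 (grad₂ k) := by
  rw [grad₂_eq hk]
  exact (InnerProductSpace.toDual ℝ (E d)).symm.contDiff.comp
    ((contDiff_kerD hk).clm_comp contDiff_const)

theorem hasFDerivAt_grad₂ (p : E d × E d) : HasFDerivAt (grad₂ k) (fderiv ℝ (grad₂ k) p) p :=
  ((contDiff_grad₂ hk).differentiable (by norm_num) p).hasFDerivAt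

theorem inner_fderiv_grad₂ (p q : E d × E d) (w : E d) :
    inner ℝ (fderiv ℝ (grad₂ k) p q) w = kerD2 k p q (0, w) := by
  have h1 : HasFDerivAt (fun r => inner ℝ w (grad₂ k r))
      ((innerSL ℝ w) ∘L fderiv ℝ (grad₂ k) p) p :=
    (innerSL ℝ w).hasFDerivAt.comp p (hasFDerivAt_grad₂ hk p)
  have h2 : HasFDerivAt (fun r => kerD k r (0, w)) ((kerD2 k p).flip (0, w)) p := by
    simpa using (hasFDerivAt_kerD hk p).clm_apply (hasFDerivAt_const ((0 : E d), w) p)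
  have h3 : (fun r => inner ℝ w (grad₂ k r)) = fun r => kerD k r (0, w) :=
    funext fun r => (real_inner_comm _ _).trans (inner_grad₂ hk r w)
  rw [h3] at h1
  have h4 := congrArg (fun L => L q) (h1.unique h2)
  exact (real_inner_comm _ _).trans h4

theorem laplacian_kernel_right (x y : E d) :
    Laplacian.laplacian (k x) y =
      ∑ l, kerD2 k (x, y) (0, EuclideanSpace.single l 1) (0, EuclideanSpace.single l 1) := by
  rw [InnerProductSpace.laplacian_eq_iteratedFDeriv_orthonormalBasis (k x)
    (EuclideanSpace.basisFun (Fin d) ℝ)]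
  refine Finset.sum_congr rfl fun l _ => ?_
  rw [iteratedFDeriv_two_apply]
  have h1 : fderiv ℝ (k x) = fun y => kerD k (x, y) ∘L ContinuousLinearMap.inr ℝ (E d) (E d) :=
    funext fun y => (hasFDerivAt_kernel_right hk x y).fderiv
  have h2 : HasFDerivAt (fun y => kerD k (x, y))
      (kerD2 k (x, y) ∘L ContinuousLinearMap.inr ℝ (E d) (E d)) y :=
    HasFDerivAt.comp (f := fun y : E d => (x, y)) (g := kerD k) y
      (hasFDerivAt_kerD hk (x, y)) (hasFDerivAt_prodMk_right x y)
  have h3 := h2.clm_comp (hasFDerivAt_const (ContinuousLinearMap.inr ℝ (E d) (E d)) y)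
  rw [h1, h3.fderiv]
  simp

end Smooth

section Bounded

variable {B : ℝ} (hB : KernelBoundedBy k B)
include hB

theorem abs_kernel_le (x y : E d) : |k x y| ≤ B := (hB (x, y)).1

theorem abs_kerD_coordDir_le (p : E d × E d) (i) : |kerD k p (coordDir d i)| ≤ B :=
  (hB p).2.1 i

theorem abs_kerD_le (p : E d × E d) (u v : E d) :
    |kerD k p (u, v)| ≤ B * √(d : ℝ) * (‖u‖ + ‖v‖) :=
  abs_apply_le_of_coordDir (abs_kerD_coordDir_le hB p) u v

variable (hk : ContDiff ℝ 2 fun p : E d × E d => k p.1 p.2)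
include hk

theorem abs_kerD2_coordDir_le (p : E d × E d) (i j) :
    |kerD2 k p (coordDir d j) (coordDir d i)| ≤ B := by
  have h2 : HasFDerivAt (fun r => kerD k r (coordDir d i)) ((kerD2 k p).flip (coordDir d i)) p := by
    simpa using (hasFDerivAt_kerD hk p).clm_apply (hasFDerivAt_const (coordDir d i) p)
  have h := (hB p).2.2 i j
  have h3 := h2.fderiv
  unfold kerD at h3
  rw [h3] at h
  simpa using h

theorem abs_kerD2_single_le (p : E d × E d) (l : Fin d) (u v : E d) :
    |kerD2 k p (u, v) (0, EuclideanSpace.single l 1)| ≤ B * √(d : ℝ) * (‖u‖ + ‖v‖) :=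
  abs_apply_le_of_coordDir (L := (kerD2 k p).flip (0, EuclideanSpace.single l 1))
    (fun i => abs_kerD2_coordDir_le hB hk p (.inr l) i) u v

theorem norm_grad₂_le (p : E d × E d) : ‖grad₂ k p‖ ≤ B * √(d : ℝ) := by
  have hB0 : 0 ≤ B := (abs_nonneg _).trans (abs_kernel_le hB 0 0)
  rw [mul_comm]
  refine norm_le_sqrt_mul hB0 _ fun l => ?_
  have h := abs_kerD_coordDir_le hB p (.inr l)
  simp only [coordDir, Sum.elim_inr] at h
  rw [← inner_grad₂ hk] at h
  simpa [EuclideanSpace.inner_single_right] using h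

theorem norm_fderiv_grad₂_le (p : E d × E d) (u v : E d) :
    ‖fderiv ℝ (grad₂ k) p (u, v)‖ ≤ B * d * (‖u‖ + ‖v‖) := by
  have hB0 : 0 ≤ B := (abs_nonneg _).trans (abs_kernel_le hB 0 0)
  have h : ‖fderiv ℝ (grad₂ k) p (u, v)‖ ≤ √(d : ℝ) * (B * √(d : ℝ) * (‖u‖ + ‖v‖)) := by
    refine norm_le_sqrt_mul (by positivity) _ fun l => ?_
    have h := abs_kerD2_single_le hB hk p l u v
    rw [← inner_fderiv_grad₂ hk] at h
    simpa [EuclideanSpace.inner_single_right] using h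
  refine h.trans_eq ?_
  have := Real.mul_self_sqrt (Nat.cast_nonneg (α := ℝ) d)
  linear_combination B * (‖u‖ + ‖v‖) * this

/-- A coordinate direction costs only one factor `√d`, against `d` in `norm_fderiv_grad₂_le`. The
Hilbert–Schmidt bound on the Jacobian relies on this gain. -/
theorem norm_fderiv_grad₂_coordDir_le (p : E d × E d) (i) :
    ‖fderiv ℝ (grad₂ k) p (coordDir d i)‖ ≤ B * √(d : ℝ) := by
  have hB0 : 0 ≤ B := (abs_nonneg _).trans (abs_kernel_le hB 0 0)
  rw [mul_comm]
  refine norm_le_sqrt_mul hB0 _ fun l => ?_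
  have h := abs_kerD2_coordDir_le hB hk p (.inr l) i
  simp only [coordDir, Sum.elim_inr] at h
  rw [← inner_fderiv_grad₂ hk] at h
  simpa [EuclideanSpace.inner_single_right, coordDir] using h

theorem abs_kernel_sub_le (x x' y y' : E d) :
    |k x y - k x' y'| ≤ B * √(d : ℝ) * (‖x - x'‖ + ‖y - y'‖) := by
  have hB0 : 0 ≤ B := (abs_nonneg _).trans (abs_kernel_le hB 0 0)
  have key : ∀ (t : ℝ), HasDerivAt (fun t : ℝ => k (x' + t • (x - x')) (y' + t • (y - y')))
      (kerD k (x' + t • (x - x'), y' + t • (y - y')) (x - x', y - y')) t := by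
    intro t
    have h1 : HasDerivAt (fun t : ℝ => (x' + t • (x - x'), y' + t • (y - y')))
        ((x - x', y - y')) t := by
      have e1 : HasDerivAt (fun t : ℝ => x' + t • (x - x')) (x - x') t := by
        simpa using ((hasDerivAt_id t).smul_const (x - x')).const_add x'
      have e2 : HasDerivAt (fun t : ℝ => y' + t • (y - y')) (y - y') t := by
        simpa using ((hasDerivAt_id t).smul_const (y - y')).const_add y'
      exact e1.prodMk e2
    exact (hasFDerivAt_kernel hk _).comp_hasDerivAt t h1
  have h := norm_image_sub_le_of_norm_deriv_le_segment_01'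
    (fun t _ => (key t).hasDerivWithinAt) (fun t _ => abs_kerD_le hB _ (x - x') (y - y'))
  simpa using h

theorem norm_grad₂_sub_le (x x' y y' : E d) :
    ‖grad₂ k (x, y) - grad₂ k (x', y')‖ ≤ B * d * (‖x - x'‖ + ‖y - y'‖) := by
  have key : ∀ (t : ℝ), HasDerivAt
      (fun t : ℝ => grad₂ k (x' + t • (x - x'), y' + t • (y - y')))
      (fderiv ℝ (grad₂ k) (x' + t • (x - x'), y' + t • (y - y')) (x - x', y - y')) t := by
    intro t
    have h1 : HasDerivAt (fun t : ℝ => (x' + t • (x - x'), y' + t • (y - y')))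
        ((x - x', y - y')) t := by
      have e1 : HasDerivAt (fun t : ℝ => x' + t • (x - x')) (x - x') t := by
        simpa using ((hasDerivAt_id t).smul_const (x - x')).const_add x'
      have e2 : HasDerivAt (fun t : ℝ => y' + t • (y - y')) (y - y') t := by
        simpa using ((hasDerivAt_id t).smul_const (y - y')).const_add y'
      exact e1.prodMk e2
    exact (hasFDerivAt_grad₂ hk _).comp_hasDerivAt t h1
  have h := norm_image_sub_le_of_norm_deriv_le_segment_01'
    (fun t _ => (key t).hasDerivWithinAt) (fun t _ => norm_fderiv_grad₂_le hB hk _ (x - x') (y - y'))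
  simpa using h

end Bounded

end Kernel

/-! ### Gradient, Laplacian and second order expansion of the potential. -/

section Potential

variable {d : ℕ} {V : E d → ℝ} (hV : ContDiff ℝ 2 V)
include hV

theorem contDiff_gradient : ContDiff ℝ 1 (gradient V) :=
  (InnerProductSpace.toDual ℝ (E d)).symm.contDiff.comp (hV.fderiv_right (by norm_num))

theorem hasFDerivAt_gradient (x : E d) : HasFDerivAt (gradient V) (hessian V x) x :=
  ((contDiff_gradient hV).differentiable (by norm_num) x).hasFDerivAt

theorem hasFDerivAt_potential (x : E d) :
    HasFDerivAt V (innerSL ℝ (gradient V x)) x :=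
  (hV.differentiable (by norm_num) x).hasGradientAt.hasFDerivAt

theorem laplacian_potential (x : E d) :
    Laplacian.laplacian V x = ∑ l, hessian V x (EuclideanSpace.single l 1) l := by
  rw [InnerProductSpace.laplacian_eq_iteratedFDeriv_orthonormalBasis V
    (EuclideanSpace.basisFun (Fin d) ℝ)]
  refine Finset.sum_congr rfl fun l _ => ?_
  rw [iteratedFDeriv_two_apply]
  have h1 : fderiv ℝ V = fun x => innerSL ℝ (gradient V x) :=
    funext fun x => (hasFDerivAt_potential hV x).fderiv
  have h2 : HasFDerivAt (fun x => innerSL ℝ (gradient V x)) ((innerSL ℝ) ∘L hessian V x) x :=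
    (innerSL ℝ).hasFDerivAt.comp x (hasFDerivAt_gradient hV x)
  rw [h1, h2.fderiv]
  change inner ℝ (hessian V x _) _ = _
  simp [EuclideanSpace.inner_single_right]

variable {C : ℝ} (hC : ∀ x, ‖hessian V x‖ ≤ C)
include hC

theorem norm_gradient_sub_le (x y : E d) : ‖gradient V x - gradient V y‖ ≤ C * ‖x - y‖ :=
  Convex.norm_image_sub_le_of_norm_hasFDerivWithin_le
    (fun z _ => (hasFDerivAt_gradient hV z).hasFDerivWithinAt) (fun z _ => hC z)
    convex_univ (Set.mem_univ _) (Set.mem_univ _)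

/-- Mean value inequality for `V` minus its linearization at `x`, on the segment from `x` to `x -
v`. It gives `C` where Taylor's formula would give `C / 2`; the constant is immaterial. -/
theorem potential_sub_le (x v : E d) :
    V (x - v) ≤ V x - inner ℝ (gradient V x) v + C * ‖v‖ ^ 2 := by
  have h := Convex.norm_image_sub_le_of_norm_hasFDerivWithin_le' (s := segment ℝ x (x - v))
    (C := C * ‖v‖) (φ := innerSL ℝ (gradient V x)) (x := x) (y := x - v)
    (fun z _ => (hasFDerivAt_potential hV z).hasFDerivWithinAt)
    (fun z hz => by
      rw [← map_sub, innerSL_apply_norm]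
      refine (norm_gradient_sub_le hV hC z x).trans ?_
      have hC0 : 0 ≤ C := (norm_nonneg _).trans (hC 0)
      refine mul_le_mul_of_nonneg_left ?_ hC0
      have := norm_sub_le_of_mem_segment hz
      simpa using this)
    (convex_segment _ _) (left_mem_segment _ _ _) (right_mem_segment _ _ _)
  have h' := (abs_le.mp (Real.norm_eq_abs _ ▸ h)).2
  simp only [sub_sub_cancel_left, norm_neg, innerSL_apply_apply, inner_neg_right] at h'
  nlinarith

end Potential

end SVGD

namespace SVGD

/-! ### Differentiability of the functions represented through a Lipschitz feature map. -/

section FeatureMap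

open Filter Topology

variable {X 𝓗 : Type*} [NormedAddCommGroup X] [NormedSpace ℝ X] [NormedAddCommGroup 𝓗]
  [InnerProductSpace ℝ 𝓗] {Ψ : X → 𝓗} {C : ℝ}

/-- The bound is uniform in `x` and linear in `h`, so convergence in the Hilbert space forces
uniform convergence of derivatives. -/
theorem norm_le_of_hasFDerivAt_inner (hC : 0 ≤ C) (hΨ : ∀ x y, ‖Ψ x - Ψ y‖ ≤ C * ‖x - y‖)
    {h : 𝓗} {L : X →L[ℝ] ℝ} {x : X}
    (hL : HasFDerivAt (fun y => inner ℝ (Ψ y) h) L x) : ‖L‖ ≤ C * ‖h‖ := by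
  refine hL.le_of_lip' (by positivity) (Eventually.of_forall fun y => ?_)
  rw [← inner_sub_left]
  calc ‖inner ℝ (Ψ y - Ψ x) h‖ ≤ ‖Ψ y - Ψ x‖ * ‖h‖ := norm_inner_le_norm _ _
    _ ≤ C * ‖y - x‖ * ‖h‖ := mul_le_mul_of_nonneg_right (hΨ y x) (norm_nonneg _)
    _ = C * ‖h‖ * ‖y - x‖ := by ring

/-- If the feature map is Lipschitz and its values span a dense subspace, then the functions
represented by the Hilbert space are differentiable as soon as the kernel sections are. -/
theorem differentiable_inner (hC : 0 ≤ C) (hΨ : ∀ x y, ‖Ψ x - Ψ y‖ ≤ C * ‖x - y‖)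
    (hdense : (Submodule.span ℝ (Set.range Ψ)).topologicalClosure = ⊤)
    (hdiff : ∀ z, Differentiable ℝ fun y => inner ℝ (Ψ y) (Ψ z)) (h : 𝓗) :
    Differentiable ℝ fun y => inner ℝ (Ψ y) h := by
  have hspan : ∀ f ∈ Submodule.span ℝ (Set.range Ψ),
      Differentiable ℝ fun y => inner ℝ (Ψ y) f := by
    intro f hf
    induction hf using Submodule.span_induction with
    | mem f hf => obtain ⟨z, rfl⟩ := hf; exact hdiff z
    | zero => simp
    | add f g _ _ hf hg => simpa only [inner_add_right] using hf.fun_add hg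
    | smul c f _ hf => simpa only [inner_smul_right] using hf.const_mul c
  have hmem : h ∈ closure (Submodule.span ℝ (Set.range Ψ) : Set 𝓗) := by
    rw [← Submodule.topologicalClosure_coe, hdense]; trivial
  obtain ⟨f, hf, hlim⟩ := mem_closure_iff_seq_limit.mp hmem
  set f' : ℕ → X → X →L[ℝ] ℝ := fun n => fderiv ℝ fun y => inner ℝ (Ψ y) (f n)
  have hf' : ∀ n x, HasFDerivAt (fun y => inner ℝ (Ψ y) (f n)) (f' n x) x :=
    fun n x => (hspan _ (hf n) x).hasFDerivAt
  have hsub : ∀ n m x, ‖f' n x - f' m x‖ ≤ C * ‖f n - f m‖ := fun n m x =>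
    norm_le_of_hasFDerivAt_inner hC hΨ
      (by simpa only [inner_sub_right] using (hf' n x).fun_sub (hf' m x))
  have hcauchy : ∀ x, CauchySeq fun n => f' n x := by
    intro x
    have h0 := hlim.cauchySeq
    rw [Metric.cauchySeq_iff] at h0 ⊢
    intro ε hε
    obtain ⟨n₀, hn₀⟩ := h0 (ε / (C + 1)) (by positivity)
    refine ⟨n₀, fun n hn m hm => ?_⟩
    have h1 := hn₀ n hn m hm
    rw [dist_eq_norm] at h1 ⊢
    calc ‖f' n x - f' m x‖ ≤ C * ‖f n - f m‖ := hsub n m x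
      _ ≤ (C + 1) * ‖f n - f m‖ := by gcongr; linarith
      _ < ε := by rwa [lt_div_iff₀' (by positivity)] at h1
  choose g' hg' using fun x => cauchySeq_tendsto_of_complete (hcauchy x)
  have hunif : TendstoUniformly f' g' atTop := by
    have hbound : ∀ n x, ‖g' x - f' n x‖ ≤ C * ‖h - f n‖ := fun n x =>
      le_of_tendsto_of_tendsto' ((hg' x).sub_const _).norm
        ((hlim.sub_const _).norm.const_mul C) fun m => hsub m n x
    have hz : Tendsto (fun n => C * ‖h - f n‖) atTop (𝓝 0) := by
      simpa using ((hlim.const_sub h).norm.const_mul C)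
    rw [Metric.tendstoUniformly_iff]
    intro ε hε
    filter_upwards [hz.eventually_lt_const hε] with n hn x
    rw [dist_eq_norm]
    exact (hbound n x).trans_lt hn
  intro x
  refine (hasFDerivAt_of_tendstoUniformly hunif hf' (fun y => ?_) x).differentiableAt
  exact tendsto_const_nhds.inner hlim

/-- Directional differentiation of the represented functions is itself represented by an element
of the Hilbert space. -/
theorem exists_inner_eq_fderiv [CompleteSpace 𝓗] (hC : 0 ≤ C)
    (hΨ : ∀ x y, ‖Ψ x - Ψ y‖ ≤ C * ‖x - y‖)
    (hdiff : ∀ h, Differentiable ℝ fun y => inner ℝ (Ψ y) h) (x v : X) :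
    ∃ D : 𝓗, ∀ h, inner ℝ D h = fderiv ℝ (fun y => inner ℝ (Ψ y) h) x v := by
  let ℓ : 𝓗 →ₗ[ℝ] ℝ :=
    { toFun := fun h => fderiv ℝ (fun y => inner ℝ (Ψ y) h) x v
      map_add' := fun f g => by
        simp only [inner_add_right]
        rw [fderiv_fun_add (hdiff f x) (hdiff g x)]
        rfl
      map_smul' := fun c f => by
        simp only [inner_smul_right]
        rw [fderiv_const_mul (hdiff f x)]
        rfl }
  let ℓ' : 𝓗 →L[ℝ] ℝ := ℓ.mkContinuous (C * ‖v‖) fun h => by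
    refine (ContinuousLinearMap.le_opNorm _ v).trans ?_
    calc _ ≤ C * ‖h‖ * ‖v‖ := mul_le_mul_of_nonneg_right
          (norm_le_of_hasFDerivAt_inner hC hΨ (hdiff h x).hasFDerivAt) (norm_nonneg _)
      _ = _ := by ring
  exact ⟨(InnerProductSpace.toDual ℝ 𝓗).symm ℓ', fun h => InnerProductSpace.toDual_symm_apply⟩

end FeatureMap

/-! ### The Stein kernel and the discrepancy of an empirical measure. -/

section SteinKernel

variable {d : ℕ} (k : E d → E d → ℝ) (V : E d → ℝ)

/-- The Stein kernel of `k` and `π ∝ exp (-V)`. -/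
noncomputable def steinKernel (x y : E d) : ℝ :=
  k x y * inner ℝ (gradient V x) (gradient V y) - kerD k (x, y) (0, gradient V x)
    - kerD k (x, y) (gradient V y, 0)
    + ∑ l, kerD2 k (x, y) (EuclideanSpace.single l 1, 0) (0, EuclideanSpace.single l 1)

/-- The squared kernelized Stein discrepancy of the empirical measure of `x`. -/
noncomputable def ksdSq {N : ℕ} (x : Fin N → E d) : ℝ :=
  ((N : ℝ)⁻¹) ^ 2 * ∑ i, ∑ j, steinKernel k V (x i) (x j)

variable {k V} (hk : (Matrix.of k).PosSemidef)

/-- The canonical feature map `x ↦ k (·, x)`. -/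
noncomputable def feature (x : E d) : H0 k hk := RKHS.kerFun (H0 k hk) x 1

theorem inner_feature (x : E d) (f : H0 k hk) : inner ℝ (feature hk x) f = f x := by
  simp [feature]

theorem feature_apply (x y : E d) : feature hk y x = k x y := by
  rw [feature, RKHS.kerFun_apply, kernel_H0]
  simp [opKernel]

theorem inner_feature_feature (x y : E d) : inner ℝ (feature hk x) (feature hk y) = k x y := by
  rw [inner_feature, feature_apply]

include hk in
theorem kernel_symm (x y : E d) : k x y = k y x := by
  rw [← inner_feature_feature hk x y, real_inner_comm, inner_feature_feature]

theorem span_feature_dense :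
    (Submodule.span ℝ (Set.range (feature hk))).topologicalClosure = ⊤ := by
  rw [eq_top_iff, ← RKHS.kerFun_dense (H0 k hk)]
  refine Submodule.topologicalClosure_mono (Submodule.span_le.mpr ?_)
  rintro _ ⟨x, v, rfl⟩
  have : RKHS.kerFun (H0 k hk) x v = v • feature hk x := by
    rw [feature, ← map_smul, smul_eq_mul, mul_one]
  rw [this]
  exact Submodule.smul_mem _ _ (Submodule.subset_span ⟨x, rfl⟩)

include hk in
-- The double sum is a sum over coordinates `l` of squared RKHS norms `‖∑ i, v i l • feature (x
-- i)‖²`.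
theorem sum_inner_mul_kernel_nonneg {ι : Type*} [Fintype ι] (x v : ι → E d) :
    0 ≤ ∑ i, ∑ j, k (x i) (x j) * inner ℝ (v i) (v j) := by
  have h : ∑ i, ∑ j, k (x i) (x j) * inner ℝ (v i) (v j)
      = ∑ l, inner ℝ (∑ i, v i l • feature hk (x i)) (∑ j, v j l • feature hk (x j)) := by
    simp only [sum_inner, inner_sum, real_inner_smul_left, real_inner_smul_right,
      inner_feature_feature]
    rw [Finset.sum_comm]
    simp only [PiLp.inner_apply, Finset.mul_sum]
    rw [Finset.sum_comm]
    conv_rhs => rw [Finset.sum_comm]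
    refine Finset.sum_congr rfl fun i _ => ?_
    rw [Finset.sum_comm]
    refine Finset.sum_congr rfl fun l _ => Finset.sum_congr rfl fun j _ => ?_
    simp only [RCLike.inner_apply, conj_trivial, kernel_symm hk (x j) (x i)]
    ring
  rw [h]
  exact Finset.sum_nonneg fun l _ => real_inner_self_nonneg

variable (hs : ContDiff ℝ 2 fun p : E d × E d => k p.1 p.2) {B : ℝ} (hB : KernelBoundedBy k B)
include hs hB

/-- The squared distance is the mixed second difference `k(x,x) - k(x,y) - k(y,x) + k(y,y)`: the
increment from `y` to `x` of `z ↦ k(x,z) - k(y,z)`, whose gradient is at most `B d ‖x - y‖`. -/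
theorem norm_feature_sub_le (x y : E d) :
    ‖feature hk x - feature hk y‖ ≤ √(B * d) * ‖x - y‖ := by
  have hB0 : 0 ≤ B := (abs_nonneg _).trans (abs_kernel_le hB 0 0)
  refine le_of_sq_le_sq ?_ (by positivity)
  rw [mul_pow, Real.sq_sqrt (by positivity), ← real_inner_self_eq_norm_sq]
  simp only [inner_sub_left, inner_sub_right, inner_feature_feature]
  have hder : ∀ z ∈ (Set.univ : Set (E d)), HasFDerivWithinAt (fun z => k x z - k y z)
      (kerD k (x, z) ∘L ContinuousLinearMap.inr ℝ (E d) (E d)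
        - kerD k (y, z) ∘L ContinuousLinearMap.inr ℝ (E d) (E d)) Set.univ z := fun z _ =>
    ((hasFDerivAt_kernel_right hs x z).sub (hasFDerivAt_kernel_right hs y z)).hasFDerivWithinAt
  have h := Convex.norm_image_sub_le_of_norm_hasFDerivWithin_le hder
    (C := B * d * ‖x - y‖) (fun z _ => ?_) convex_univ (Set.mem_univ y) (Set.mem_univ x)
  · have h1 := (le_abs_self _).trans (Real.norm_eq_abs _ ▸ h)
    calc _ = k x x - k y x - (k x y - k y y) := by ring
      _ ≤ _ := h1
      _ = _ := by ring
  · refine ContinuousLinearMap.opNorm_le_bound _ (by positivity) fun w => ?_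
    have e : (kerD k (x, z) ∘L ContinuousLinearMap.inr ℝ (E d) (E d)
        - kerD k (y, z) ∘L ContinuousLinearMap.inr ℝ (E d) (E d)) w
        = inner ℝ (grad₂ k (x, z) - grad₂ k (y, z)) w := by
      rw [inner_sub_left, inner_grad₂ hs, inner_grad₂ hs]; simp
    rw [e]
    refine (norm_inner_le_norm _ _).trans (mul_le_mul_of_nonneg_right ?_ (norm_nonneg _))
    simpa using norm_grad₂_sub_le hB hs x y z z

theorem differentiable_inner_feature (f : H0 k hk) :
    Differentiable ℝ fun y => inner ℝ (feature hk y) f := by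
  refine differentiable_inner (Real.sqrt_nonneg _) (norm_feature_sub_le hk hs hB)
    (span_feature_dense hk) (fun z => ?_) f
  simp only [inner_feature_feature]
  exact fun y => (hasFDerivAt_kernel_left hs y z).differentiableAt

omit hB in
include hk in
theorem kerD_swap (x y v : E d) : kerD k (y, x) (v, 0) = kerD k (x, y) (0, v) := by
  have e : (fun z => k z x) = k x := funext fun z => kernel_symm hk z x
  have h2 := hasFDerivAt_kernel_left hs y x
  rw [e] at h2
  simpa using congrArg (fun L => L v) (h2.unique (hasFDerivAt_kernel_right hs x y))

/-- The element of the reproducing kernel Hilbert space representing `f ↦ ∂_v f (x)`. -/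
theorem exists_featureDeriv : ∃ D : E d → E d → H0 k hk,
    (∀ x v f, inner ℝ (D x v) f = fderiv ℝ (fun y => inner ℝ (feature hk y) f) x v) ∧
    (∀ x v y, inner ℝ (D x v) (feature hk y) = kerD k (x, y) (v, 0)) ∧
    ∀ x v y w, inner ℝ (D x v) (D y w) = kerD2 k (x, y) (v, 0) (0, w) := by
  choose D hD using exists_inner_eq_fderiv (Real.sqrt_nonneg _) (norm_feature_sub_le hk hs hB)
    (differentiable_inner_feature hk hs hB)
  have h1 : ∀ x v y, inner ℝ (D x v) (feature hk y) = kerD k (x, y) (v, 0) := by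
    intro x v y
    rw [hD]
    simp only [inner_feature_feature]
    rw [(hasFDerivAt_kernel_left hs x y).fderiv]
    simp
  refine ⟨D, hD, h1, fun x v y w => ?_⟩
  rw [hD]
  have e : (fun z => inner ℝ (feature hk z) (D y w)) = fun z => kerD k (z, y) (0, w) := by
    funext z
    rw [real_inner_comm, h1, kerD_swap hk hs]
  have h2 : HasFDerivAt (fun z => kerD k (z, y))
      (kerD2 k (x, y) ∘L ContinuousLinearMap.inl ℝ (E d) (E d)) x :=
    HasFDerivAt.comp (f := fun z : E d => (z, y)) (g := kerD k) x
      (hasFDerivAt_kerD hs (x, y)) (hasFDerivAt_prodMk_left x y)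
  rw [e, (h2.clm_apply (hasFDerivAt_const ((0 : E d), w) x)).fderiv]
  simp

/-- Every field in `H` is genuinely differentiable, so the divergence in `stein` is never the
default value zero of `fderiv`. -/
theorem fderiv_field (φ : H k hk) (x : E d) (l : Fin d) (v : E d) :
    fderiv ℝ (field φ) x v l = fderiv ℝ (fun y => inner ℝ (feature hk y) (φ l)) x v := by
  have h : HasFDerivAt (field φ) ((PiLp.continuousLinearEquiv 2 ℝ fun _ : Fin d => ℝ).symm.toContinuousLinearMap
      ∘L ContinuousLinearMap.pi fun l => fderiv ℝ (fun y => inner ℝ (feature hk y) (φ l)) x) x := by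
    have h1 : HasFDerivAt (fun y l => φ l y)
        (ContinuousLinearMap.pi fun l => fderiv ℝ (fun y => inner ℝ (feature hk y) (φ l)) x) x := by
      refine hasFDerivAt_pi.mpr fun l => ?_
      have := (differentiable_inner_feature hk hs hB (φ l) x).hasFDerivAt
      simpa only [inner_feature] using this
    exact ((PiLp.continuousLinearEquiv 2 ℝ fun _ : Fin d => ℝ).symm.toContinuousLinearMap).hasFDerivAt.comp
      x h1
  rw [h.fderiv]
  simp

omit hs hB in
theorem integral_empirical {N : ℕ} (x : Fin N → E d) (f : E d → ℝ) :
    ∫ y, f y ∂empirical x = (N : ℝ)⁻¹ * ∑ i, f (x i) := by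
  rw [empirical, integral_smul_measure, integral_finsetSum_measure]
  · simp
  · intro i _
    exact integrable_dirac (by simp)

omit hs hB in
theorem sum_mul_apply_single (R : E d →L[ℝ] ℝ) (u : E d) :
    ∑ l, u l * R (EuclideanSpace.single l 1) = R u := by
  conv_rhs => rw [← sum_smul_single u, map_sum]
  simp

/-- The functional `φ ↦ stein V φ y` is represented by `η y ∈ H`, and `⟪η y, η z⟫` is the Stein
kernel. Averaging over the particles gives a representer `ξ` with `‖ξ‖² = ksdSq`, and Cauchy–Schwarz
bounds the supremum. Equality also holds, but only this direction is needed. -/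
theorem KSD_empirical_sq_le {N : ℕ} (x : Fin N → E d) :
    0 ≤ ksdSq k V x ∧ KSD k hk V (empirical x) ^ 2 ≤ ENNReal.ofReal (ksdSq k V x) := by
  obtain ⟨D, hD, hDf, hDD⟩ := exists_featureDeriv hk hs hB
  let η : E d → Fin d → H0 k hk := fun y l =>
    D y (EuclideanSpace.single l 1) - gradient V y l • feature hk y
  have hη : ∀ y z, ∑ l, inner ℝ (η y l) (η z l) = steinKernel k V y z := by
    intro y z
    have e : ∀ l, inner ℝ (η y l) (η z l) =
        kerD2 k (y, z) (EuclideanSpace.single l 1, 0) (0, EuclideanSpace.single l 1)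
        - gradient V z l * kerD k (y, z) (EuclideanSpace.single l 1, 0)
        - gradient V y l * kerD k (y, z) (0, EuclideanSpace.single l 1)
        + k y z * (gradient V y l * gradient V z l) := by
      intro l
      simp only [η, inner_sub_left, inner_sub_right, real_inner_smul_left, real_inner_smul_right,
        inner_feature_feature, hDf, hDD, real_inner_comm (D z _) (feature hk y),
        kerD_swap hk hs y z]
      ring
    simp only [e, Finset.sum_add_distrib, Finset.sum_sub_distrib]
    have h1 := sum_mul_apply_single
      (kerD k (y, z) ∘L ContinuousLinearMap.inl ℝ (E d) (E d)) (gradient V z)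
    have h2 := sum_mul_apply_single
      (kerD k (y, z) ∘L ContinuousLinearMap.inr ℝ (E d) (E d)) (gradient V y)
    simp only [ContinuousLinearMap.comp_apply, ContinuousLinearMap.inl_apply,
      ContinuousLinearMap.inr_apply] at h1 h2
    rw [h1, h2, ← Finset.mul_sum, steinKernel, PiLp.inner_apply]
    simp only [RCLike.inner_apply, conj_trivial, mul_comm (gradient V z _)]
    ring
  let ξ : H k hk := WithLp.toLp 2 fun l => (N : ℝ)⁻¹ • ∑ i, η (x i) l
  have hξ : ‖ξ‖ ^ 2 = ksdSq k V x := by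
    rw [← real_inner_self_eq_norm_sq, PiLp.inner_apply, ksdSq]
    simp only [ξ, real_inner_smul_left, real_inner_smul_right, sum_inner, inner_sum, ← hη,
      Finset.mul_sum]
    rw [Finset.sum_comm]
    refine Finset.sum_congr rfl fun i _ => ?_
    rw [Finset.sum_comm]
    exact Finset.sum_congr rfl fun j _ => Finset.sum_congr rfl fun l _ => by
      rw [real_inner_comm]; ring
  have hstein : ∀ (φ : H k hk) (y), stein V (field φ) y = ∑ l, inner ℝ (η y l) (φ l) := by
    intro φ y
    simp only [stein, fderiv_field hk hs hB, η, inner_sub_left, real_inner_smul_left, hD,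
      Finset.sum_sub_distrib, PiLp.inner_apply, inner_feature, field, RCLike.inner_apply,
      conj_trivial, mul_comm (φ _ y)]
    ring
  have h0 : 0 ≤ ksdSq k V x := hξ ▸ sq_nonneg _
  refine ⟨h0, ?_⟩
  have hle : KSD k hk V (empirical x) ≤ ENNReal.ofReal ‖ξ‖ := by
    refine iSup₂_le fun φ hφ => ENNReal.ofReal_le_ofReal ?_
    have e : ∫ y, stein V (field φ) y ∂empirical x = inner ℝ ξ φ := by
      rw [integral_empirical, PiLp.inner_apply]
      simp only [hstein, ξ, real_inner_smul_left, sum_inner]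
      rw [← Finset.mul_sum, Finset.sum_comm]
    rw [e]
    refine (real_inner_le_norm _ _).trans ?_
    exact mul_le_of_le_one_right (norm_nonneg _) hφ
  rw [← hξ, ENNReal.ofReal_pow (norm_nonneg _)]
  gcongr

end SteinKernel

end SVGD

namespace SVGD

/-! ### A second order lower bound for `log |det (1 - M)|`. -/

section Determinant

open Matrix

variable {ι : Type*} [Fintype ι] [DecidableEq ι]

/-- Each eigenvalue satisfies `λ ≤ exp (λ - 1)`. -/
theorem det_le_exp_trace_sub_card {P : Matrix ι ι ℝ} (hP : P.PosSemidef) :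
    P.det ≤ Real.exp (P.trace - Fintype.card ι) := by
  rw [hP.isHermitian.det_eq_prod_eigenvalues, hP.isHermitian.trace_eq_sum_eigenvalues]
  have h : (∑ i, hP.isHermitian.eigenvalues i) - (Fintype.card ι : ℝ)
      = ∑ i, (hP.isHermitian.eigenvalues i - 1) := by
    simp [Finset.sum_sub_distrib]
  simp only [RCLike.ofReal_real_eq_id, id_eq]
  rw [h, Real.exp_sum]
  refine Finset.prod_le_prod (fun i _ => hP.eigenvalues_nonneg i) fun i _ => ?_
  have := Real.add_one_le_exp (hP.isHermitian.eigenvalues i - 1)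
  linarith

variable {M : Matrix ι ι ℝ} (hM : ∀ v, (M *ᵥ v) ⬝ᵥ (M *ᵥ v) ≤ (1 / 4) * (v ⬝ᵥ v))
include hM

theorem dotProduct_self_le_of_one_sub (v : ι → ℝ) :
    v ⬝ᵥ v ≤ 4 * (((1 - M) *ᵥ v) ⬝ᵥ ((1 - M) *ᵥ v)) := by
  have h : v ⬝ᵥ v ≤ 2 * (((1 - M) *ᵥ v) ⬝ᵥ ((1 - M) *ᵥ v)) + 2 * ((M *ᵥ v) ⬝ᵥ (M *ᵥ v)) := by
    simp only [dotProduct, Finset.mul_sum, ← Finset.sum_add_distrib]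
    refine Finset.sum_le_sum fun i _ => ?_
    have e : v i = ((1 - M) *ᵥ v) i + (M *ᵥ v) i := by simp [Matrix.sub_mulVec]
    rw [e]
    nlinarith [sq_nonneg (((1 - M) *ᵥ v) i - (M *ᵥ v) i)]
  linarith [hM v]

theorem det_one_sub_ne_zero : (1 - M).det ≠ 0 := by
  intro h
  obtain ⟨v, hv, hv0⟩ := Matrix.exists_mulVec_eq_zero_iff.mpr h
  have h1 := dotProduct_self_le_of_one_sub hM v
  rw [hv0] at h1
  simp only [dotProduct_zero, mul_zero] at h1
  have h2 : 0 ≤ v ⬝ᵥ v := Finset.sum_nonneg fun i _ => mul_self_nonneg _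
  exact hv (dotProduct_self_eq_zero.mp (le_antisymm h1 h2))

/-- With `P = (1 - M)⁻¹ = 1 + F`, the trace inequality for `P Pᵀ` gives `-log |det (1 - M)| ≤ tr F +
‖F‖² / 2` in Hilbert–Schmidt norm. Then `F = M + F M` and `‖F‖² ≤ 4 ‖M‖²` reduce this to `M`. No
symmetry of `M` is required. -/
theorem neg_log_abs_det_one_sub_le :
    -Real.log |(1 - M).det| ≤ M.trace + 4 * ∑ j, ∑ i, M i j ^ 2 := by
  have hdet := det_one_sub_ne_zero hM
  have hunit : IsUnit (1 - M).det := isUnit_iff_ne_zero.mpr hdet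
  set P := (1 - M)⁻¹ with hPdef
  have hPA : P * (1 - M) = 1 := Matrix.nonsing_inv_mul _ hunit
  have hAP : (1 - M) * P = 1 := Matrix.mul_nonsing_inv _ hunit
  set F := P * M with hF
  have hP : P = 1 + F := by rw [hF, ← hPA]; simp [mul_sub]
  have hF2 : F = M + F * M := by
    conv_lhs => rw [hF, hP]
    rw [add_mul, one_mul]
  have hPbound : ∀ w, (P *ᵥ w) ⬝ᵥ (P *ᵥ w) ≤ 4 * (w ⬝ᵥ w) := by
    intro w
    have h := dotProduct_self_le_of_one_sub hM (P *ᵥ w)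
    simpa [Matrix.mulVec_mulVec, hAP] using h
  have hFcol : ∑ j, ∑ i, F i j ^ 2 ≤ 4 * ∑ j, ∑ i, M i j ^ 2 := by
    rw [Finset.mul_sum]
    refine Finset.sum_le_sum fun j _ => ?_
    have h := hPbound (fun i => M i j)
    simpa [dotProduct, ← sq, hF, Matrix.mul_apply, Matrix.mulVec] using h
  have htrF : F.trace ≤ M.trace + 2 * ∑ j, ∑ i, M i j ^ 2 := by
    have h1 : F.trace = M.trace + (F * M).trace := by
      conv_lhs => rw [hF2]
      rw [Matrix.trace_add]
    have h2 : (F * M).trace ≤ (1 / 4) * ∑ i, ∑ j, F i j ^ 2 + ∑ i, ∑ j, M j i ^ 2 := by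
      simp only [Matrix.trace, Matrix.diag, Matrix.mul_apply, Finset.mul_sum,
        ← Finset.sum_add_distrib]
      refine Finset.sum_le_sum fun i _ => Finset.sum_le_sum fun j _ => ?_
      -- The weights `1/4` and `1` in Young's inequality, with `‖F‖² ≤ 4 ‖M‖²`, yield `tr (F M) ≤ 2
      -- ‖M‖²`; adding `‖F‖² / 2 ≤ 2 ‖M‖²` makes the final constant `4`.
      nlinarith [sq_nonneg (F i j / 2 - M j i)]
    rw [Finset.sum_comm] at h2
    linarith
  have htr : (P * Pᴴ).trace = Fintype.card ι + 2 * F.trace + ∑ j, ∑ i, F i j ^ 2 := by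
    have h1 : (P * Pᴴ).trace = ((1 : Matrix ι ι ℝ)).trace + 2 * F.trace + (F * Fᵀ).trace := by
      rw [hP]
      simp only [conjTranspose_eq_transpose_of_trivial, transpose_add, transpose_one, mul_add,
        add_mul, one_mul, mul_one, trace_add, trace_transpose]
      ring
    rw [h1, Matrix.trace_one, Finset.sum_comm]
    simp [Matrix.trace, Matrix.mul_apply, sq]
  have hdetP : (P * Pᴴ).det = (|(1 - M).det| ^ 2)⁻¹ := by
    rw [det_mul, det_conjTranspose, star_trivial, hPdef, det_nonsing_inv,
      Ring.inverse_eq_inv', sq_abs, sq, mul_inv]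
  have h := det_le_exp_trace_sub_card (Matrix.posSemidef_self_mul_conjTranspose P)
  rw [hdetP, htr] at h
  have hpos : 0 < (|(1 - M).det| ^ 2)⁻¹ := by positivity
  have h3 := (Real.log_le_iff_le_exp hpos).mpr h
  rw [Real.log_inv, Real.log_pow] at h3
  push_cast at h3
  linarith

end Determinant

/-! ### Transfer of the determinant bound to operators on `(ℝ^d)^N`. -/

section BlockDeterminant

variable {N d : ℕ}

/-- The coordinate vectors of `(ℝ^d)^N`. -/
noncomputable def unitVec (i : Fin N) (m : Fin d) : Fin N → E d :=
  Pi.single i (EuclideanSpace.single m 1)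

/-- The coordinate basis of `(ℝ^d)^N`. -/
noncomputable def unitBasis (N d : ℕ) : Module.Basis (Σ _ : Fin N, Fin d) ℝ (Fin N → E d) :=
  Pi.basis fun _ => (EuclideanSpace.basisFun (Fin d) ℝ).toBasis

theorem unitBasis_apply (p : Σ _ : Fin N, Fin d) : unitBasis N d p = unitVec p.1 p.2 := by
  simp [unitBasis, unitVec]

theorem unitBasis_repr (u : Fin N → E d) (p : Σ _ : Fin N, Fin d) :
    (unitBasis N d).repr u p = u p.1 p.2 := by
  simp [unitBasis, Pi.basis_repr]

theorem sum_sq_eq (u : Fin N → E d) : ∑ p : Σ _ : Fin N, Fin d, u p.1 p.2 ^ 2 = ∑ i, ‖u i‖ ^ 2 := by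
  rw [Fintype.sum_sigma]
  exact Finset.sum_congr rfl fun i _ => by rw [EuclideanSpace.real_norm_sq_eq]

theorem det_id_sub_ne_zero_and_neg_log_le {L : (Fin N → E d) →L[ℝ] (Fin N → E d)}
    (hL : ∀ u, ∑ i, ‖L u i‖ ^ 2 ≤ (1 / 4) * ∑ i, ‖u i‖ ^ 2) :
    (ContinuousLinearMap.id ℝ _ - L).det ≠ 0 ∧
    -Real.log |(ContinuousLinearMap.id ℝ _ - L).det| ≤
      ∑ i, ∑ m, L (unitVec i m) i m + 4 * ∑ l, ∑ m, ∑ i, ‖L (unitVec l m) i‖ ^ 2 := by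
  set b := unitBasis N d
  set M := LinearMap.toMatrix b b (L : (Fin N → E d) →ₗ[ℝ] (Fin N → E d)) with hMdef
  have hM : ∀ v, (M.mulVec v) ⬝ᵥ (M.mulVec v) ≤ (1 / 4) * (v ⬝ᵥ v) := by
    intro v
    obtain ⟨u, rfl⟩ : ∃ u, v = b.repr u := ⟨b.equivFun.symm v, by
      rw [← Module.Basis.equivFun_apply, LinearEquiv.apply_symm_apply]⟩
    rw [hMdef, LinearMap.toMatrix_mulVec_repr]
    simp only [dotProduct, ← sq, b, unitBasis_repr, sum_sq_eq]
    exact hL u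
  have hdet : (ContinuousLinearMap.id ℝ (Fin N → E d) - L).det = (1 - M).det := by
    rw [ContinuousLinearMap.det, ← LinearMap.det_toMatrix b]
    congr 1
    simp [hMdef]
  have hent : ∀ p q, M p q = L (unitVec q.1 q.2) p.1 p.2 := by
    intro p q
    rw [hMdef, LinearMap.toMatrix_apply, unitBasis_repr, unitBasis_apply]
    rfl
  rw [hdet]
  refine ⟨det_one_sub_ne_zero hM, (neg_log_abs_det_one_sub_le hM).trans_eq ?_⟩
  simp only [Matrix.trace, Matrix.diag, hent, Fintype.sum_sigma, EuclideanSpace.real_norm_sq_eq]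

end BlockDeterminant

end SVGD

namespace SVGD

/-! ### Cauchy–Schwarz for particle averages. -/

section Averages

variable {N : ℕ}

theorem sq_average_le (z : Fin N → ℝ) : ((N : ℝ)⁻¹ * ∑ j, z j) ^ 2 ≤ (N : ℝ)⁻¹ * ∑ j, z j ^ 2 := by
  rcases Nat.eq_zero_or_pos N with rfl | hN
  · simp
  have hN' : (0 : ℝ) < N := Nat.cast_pos.mpr hN
  have h := sq_sum_le_card_mul_sum_sq (s := Finset.univ) (f := z)
  simp only [Finset.card_univ, Fintype.card_fin] at h
  calc ((N : ℝ)⁻¹ * ∑ j, z j) ^ 2 = (N : ℝ)⁻¹ ^ 2 * (∑ j, z j) ^ 2 := by ring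
    _ ≤ (N : ℝ)⁻¹ ^ 2 * (N * ∑ j, z j ^ 2) := by gcongr
    _ = _ := by field_simp

theorem average_le_of_average_sq_le {z : Fin N → ℝ} {r : ℝ} (hr : 0 ≤ r)
    (h : (N : ℝ)⁻¹ * ∑ j, z j ^ 2 ≤ r ^ 2) : (N : ℝ)⁻¹ * ∑ j, z j ≤ r :=
  le_of_sq_le_sq ((sq_average_le z).trans h) hr

/-- This models the mean-field form of the Jacobian, in which row `i` averages over `j` terms
depending on particles `i` and `j` only. The operator bound depends on the mean square of `c`, with
no extra factor of `N`. -/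
theorem sum_sq_average_add_le (c t : Fin N → ℝ) :
    ∑ i, ((N : ℝ)⁻¹ * ∑ j, c j * (t i + t j)) ^ 2
      ≤ 4 * ((N : ℝ)⁻¹ * ∑ j, c j ^ 2) * ∑ i, t i ^ 2 := by
  rcases Nat.eq_zero_or_pos N with rfl | hN
  · simp
  have hN' : (0 : ℝ) < N := Nat.cast_pos.mpr hN
  set Q := (N : ℝ)⁻¹ * ∑ j, c j ^ 2 with hQ
  set R := ∑ i, t i ^ 2
  have h1 : ((N : ℝ)⁻¹ * ∑ j, c j) ^ 2 ≤ Q := sq_average_le c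
  have h2 : ((N : ℝ)⁻¹ * ∑ j, c j * t j) ^ 2 ≤ (N : ℝ)⁻¹ * (Q * R) := by
    have h := Finset.sum_mul_sq_le_sq_mul_sq Finset.univ c t
    calc _ = (N : ℝ)⁻¹ ^ 2 * (∑ j, c j * t j) ^ 2 := by ring
      _ ≤ (N : ℝ)⁻¹ ^ 2 * ((∑ j, c j ^ 2) * R) := by gcongr
      _ = _ := by rw [hQ]; ring
  calc _ ≤ ∑ i, (2 * (Q * t i ^ 2) + 2 * ((N : ℝ)⁻¹ * (Q * R))) := by
        refine Finset.sum_le_sum fun i _ => ?_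
        have e : (N : ℝ)⁻¹ * ∑ j, c j * (t i + t j)
            = ((N : ℝ)⁻¹ * ∑ j, c j) * t i + (N : ℝ)⁻¹ * ∑ j, c j * t j := by
          simp only [mul_add, Finset.sum_add_distrib, ← Finset.sum_mul]; ring
        rw [e]
        have h3 : ((N : ℝ)⁻¹ * ∑ j, c j) ^ 2 * t i ^ 2 ≤ Q * t i ^ 2 := by gcongr
        nlinarith [sq_nonneg (((N : ℝ)⁻¹ * ∑ j, c j) * t i - (N : ℝ)⁻¹ * ∑ j, c j * t j)]
    _ = _ := by
        simp only [Finset.sum_add_distrib, ← Finset.mul_sum, Finset.sum_const, Finset.card_univ,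
          Fintype.card_fin, nsmul_eq_mul]
        field_simp
        ring

end Averages

/-! ### The drift, its Jacobian, and the dissipation identity. -/

section Drift

variable {d N : ℕ} (k : E d → E d → ℝ) (V : E d → ℝ)

/-- The drift of SVGD, so that one iteration is `x ↦ x - η • drift k V x`. -/
noncomputable def drift (x : Fin N → E d) : Fin N → E d := fun i =>
  (N : ℝ)⁻¹ • ∑ j, (k (x i) (x j) • gradient V (x j) - grad₂ k (x i, x j))

/-- The derivative of the drift. -/
noncomputable def driftD (x : Fin N → E d) : (Fin N → E d) →L[ℝ] (Fin N → E d) :=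
  ContinuousLinearMap.pi fun i => (N : ℝ)⁻¹ • ∑ j,
    (k (x i) (x j) • (hessian V (x j) ∘L ContinuousLinearMap.proj j)
      + (kerD k (x i, x j) ∘L
          (ContinuousLinearMap.proj i).prod (ContinuousLinearMap.proj j)).smulRight
            (gradient V (x j))
      - fderiv ℝ (grad₂ k) (x i, x j) ∘L
          (ContinuousLinearMap.proj i).prod (ContinuousLinearMap.proj j))

theorem driftD_apply (x u : Fin N → E d) (i : Fin N) : driftD k V x u i =
    (N : ℝ)⁻¹ • ∑ j, (k (x i) (x j) • hessian V (x j) (u j)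
      + kerD k (x i, x j) (u i, u j) • gradient V (x j)
      - fderiv ℝ (grad₂ k) (x i, x j) (u i, u j)) := by
  simp [driftD]

theorem step_eq (η : ℝ) (x : Fin N → E d) : step k V η x = x - η • drift k V x := by
  funext i
  simp only [step, drift, Pi.sub_apply, Pi.smul_apply, smul_smul, div_eq_mul_inv]
  rfl

variable {k V}

section Regularity

variable (hk : ContDiff ℝ 2 fun p : E d × E d => k p.1 p.2) (hV : ContDiff ℝ 2 V)
include hk hV

theorem hasFDerivAt_drift (x : Fin N → E d) : HasFDerivAt (drift k V) (driftD k V x) x := by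
  refine hasFDerivAt_pi.mpr fun i => ?_
  have hpair : ∀ j, HasFDerivAt (fun y : Fin N → E d => (y i, y j))
      ((ContinuousLinearMap.proj (R := ℝ) (φ := fun _ : Fin N => E d) i).prod
        (ContinuousLinearMap.proj j)) x :=
    fun j => (hasFDerivAt_apply i x).prodMk (hasFDerivAt_apply j x)
  have h1 := fun j => HasFDerivAt.comp (f := fun y : Fin N → E d => (y i, y j))
    (g := fun q : E d × E d => k q.1 q.2) x (hasFDerivAt_kernel hk (x i, x j)) (hpair j)
  have h2 := fun j => HasFDerivAt.comp (f := fun y : Fin N → E d => y j) (g := gradient V) x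
    (hasFDerivAt_gradient hV (x j)) (hasFDerivAt_apply j x)
  have h3 := fun j => HasFDerivAt.comp (f := fun y : Fin N → E d => (y i, y j))
    (g := grad₂ k) x (hasFDerivAt_grad₂ hk (x i, x j)) (hpair j)
  have h4 : HasFDerivAt (fun y : Fin N → E d => ∑ j, (k (y i) (y j) • gradient V (y j)
      - grad₂ k (y i, y j))) _ x :=
    HasFDerivAt.fun_sum fun j _ => ((h1 j).fun_smul (h2 j)).fun_sub (h3 j)
  exact h4.fun_const_smul (N : ℝ)⁻¹

theorem hasFDerivAt_step (η : ℝ) (x : Fin N → E d) :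
    HasFDerivAt (step k V η) (ContinuousLinearMap.id ℝ _ - η • driftD k V x) x := by
  rw [funext (step_eq k V η)]
  exact (hasFDerivAt_id x).fun_sub ((hasFDerivAt_drift hk hV x).const_smul η)

theorem differentiable_step (η : ℝ) : Differentiable ℝ (step (N := N) k V η) :=
  fun x => (hasFDerivAt_step hk hV η x).differentiableAt

theorem trace_driftD (x : Fin N → E d) : ∑ i, ∑ m, driftD k V x (unitVec i m) i m =
    (N : ℝ)⁻¹ * ∑ i, ∑ j, (kerD k (x i, x j) (gradient V (x j), 0)
      - ∑ m, kerD2 k (x i, x j) (EuclideanSpace.single m 1, 0) (0, EuclideanSpace.single m 1))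
    + (N : ℝ)⁻¹ * ∑ i, Cstar k V (x i) := by
  have hfd : ∀ p q m, fderiv ℝ (grad₂ k) p q m = kerD2 k p q (0, EuclideanSpace.single m 1) := by
    intro p q m
    rw [← inner_fderiv_grad₂ hk]
    simp [EuclideanSpace.inner_single_right]
  rw [← mul_add, ← Finset.sum_add_distrib, Finset.mul_sum]
  refine Finset.sum_congr rfl fun i _ => ?_
  have hC : Cstar k V (x i) = ∑ m, (kerD k (x i, x i) (0, EuclideanSpace.single m 1)
        * gradient V (x i) m + k (x i) (x i) * hessian V (x i) (EuclideanSpace.single m 1) m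
        - kerD2 k (x i, x i) (0, EuclideanSpace.single m 1) (0, EuclideanSpace.single m 1)) := by
    rw [Cstar, laplacian_potential hV, laplacian_kernel_right hk, Finset.sum_sub_distrib,
      Finset.sum_add_distrib, ← Finset.mul_sum]
    have h1 := sum_mul_apply_single (kerD k (x i, x i) ∘L ContinuousLinearMap.inr ℝ (E d) (E d))
      (gradient V (x i))
    simp only [ContinuousLinearMap.comp_apply, ContinuousLinearMap.inr_apply] at h1
    have h2 : inner ℝ (gradient (k (x i)) (x i)) (gradient V (x i))
        = kerD k (x i, x i) (0, gradient V (x i)) := inner_grad₂ hk (x i, x i) _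
    rw [h2, ← h1]
    simp only [mul_comm]
  have hj : ∀ j, kerD k (x i, x j) (gradient V (x j), 0)
      = ∑ m, kerD k (x i, x j) (EuclideanSpace.single m 1, 0) * gradient V (x j) m := by
    intro j
    have h1 := sum_mul_apply_single (kerD k (x i, x j) ∘L ContinuousLinearMap.inl ℝ (E d) (E d))
      (gradient V (x j))
    simp only [ContinuousLinearMap.comp_apply, ContinuousLinearMap.inl_apply] at h1
    rw [← h1]
    simp only [mul_comm]
  simp only [hj, ← Finset.sum_sub_distrib]
  rw [Finset.sum_comm, hC, ← Finset.sum_add_distrib, Finset.mul_sum]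
  refine Finset.sum_congr rfl fun m _ => ?_
  rw [driftD_apply]
  simp only [PiLp.smul_apply, smul_eq_mul, WithLp.ofLp_sum, Finset.sum_apply, PiLp.sub_apply,
    PiLp.add_apply]
  congr 1
  -- Moving particle `i` changes the first argument of every summand, and also the second argument
  -- and `∇V` when `j = i`; this diagonal contribution is the source of `Cstar`.
  have hsplit : ∀ j, k (x i) (x j) * hessian V (x j) (unitVec i m j) m
      + kerD k (x i, x j) (unitVec i m i, unitVec i m j) * gradient V (x j) m
      - (fderiv ℝ (grad₂ k) (x i, x j) (unitVec i m i, unitVec i m j)) m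
      = (kerD k (x i, x j) (EuclideanSpace.single m 1, 0) * gradient V (x j) m
        - kerD2 k (x i, x j) (EuclideanSpace.single m 1, 0) (0, EuclideanSpace.single m 1))
      + if j = i then (kerD k (x i, x i) (0, EuclideanSpace.single m 1)
        * gradient V (x i) m + k (x i) (x i) * hessian V (x i) (EuclideanSpace.single m 1) m
        - kerD2 k (x i, x i) (0, EuclideanSpace.single m 1) (0, EuclideanSpace.single m 1))
        else 0 := by
    intro j
    have hi : unitVec i m i = (EuclideanSpace.single m 1 : E d) := by simp [unitVec]
    rw [hi, hfd]
    by_cases hji : j = i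
    · subst hji
      rw [hi, if_pos rfl]
      have e : ((EuclideanSpace.single m 1 : E d), (EuclideanSpace.single m 1 : E d))
          = (EuclideanSpace.single m 1, 0) + (0, EuclideanSpace.single m 1) := by simp
      rw [e, map_add, map_add, add_apply]
      ring
    · have h0 : unitVec i m j = (0 : E d) := by simp [unitVec, hji]
      rw [h0, if_neg hji]
      simp
  rw [Finset.sum_congr rfl fun j _ => hsplit j, Finset.sum_add_distrib]
  simp

/-- The pairing with `∇V` supplies the first two terms of the Stein kernel, and the off-diagonal
form of the divergence the other two. The self-interaction `Cstar` enters with weight `1 / N`, which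
limits the final rate. -/
theorem inner_gradient_drift_sub_trace (x : Fin N → E d) :
    ∑ i, inner ℝ (gradient V (x i)) (drift k V x i) - ∑ i, ∑ m, driftD k V x (unitVec i m) i m
      = N * ksdSq k V x - (N : ℝ)⁻¹ * ∑ i, Cstar k V (x i) := by
  rcases Nat.eq_zero_or_pos N with rfl | hN
  · simp
  rw [trace_driftD hk hV, ksdSq]
  have h1 : ∑ i, inner ℝ (gradient V (x i)) (drift k V x i) = (N : ℝ)⁻¹ * ∑ i, ∑ j,
      (k (x i) (x j) * inner ℝ (gradient V (x i)) (gradient V (x j))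
        - kerD k (x i, x j) (0, gradient V (x i))) := by
    rw [Finset.mul_sum]
    refine Finset.sum_congr rfl fun i _ => ?_
    simp only [drift, real_inner_smul_right, inner_sum, inner_sub_right,
      real_inner_comm (grad₂ k _) (gradient V _), inner_grad₂ hk]
  have h2 : (N : ℝ) * ((N : ℝ)⁻¹ ^ 2 * ∑ i, ∑ j, steinKernel k V (x i) (x j))
      = (N : ℝ)⁻¹ * ∑ i, ∑ j, steinKernel k V (x i) (x j) := by
    have hN' : (N : ℝ) ≠ 0 := Nat.cast_ne_zero.mpr hN.ne'
    field_simp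
  rw [h1, h2, sub_add_eq_sub_sub, ← mul_sub, ← Finset.sum_sub_distrib]
  congr 2
  refine Finset.sum_congr rfl fun i _ => ?_
  rw [← Finset.sum_sub_distrib]
  exact Finset.sum_congr rfl fun j _ => by rw [steinKernel]; ring

end Regularity

/-! ### Bounds on the drift and its Jacobian in terms of the mean square gradient. -/

section Estimates

variable (hk : ContDiff ℝ 2 fun p : E d × E d => k p.1 p.2) (hV : ContDiff ℝ 2 V)
  {B C : ℝ} (hB : KernelBoundedBy k B) (hC : ∀ x, ‖hessian V x‖ ≤ C)
include hB

include hk in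
theorem norm_drift_le (x : Fin N → E d) (i : Fin N) :
    ‖drift k V x i‖ ≤ (N : ℝ)⁻¹ * ∑ j, (B * ‖gradient V (x j)‖ + B * √(d : ℝ)) := by
  rw [drift, norm_smul, Real.norm_of_nonneg (by positivity)]
  refine mul_le_mul_of_nonneg_left ((norm_sum_le _ _).trans ?_) (by positivity)
  refine Finset.sum_le_sum fun j _ => (norm_sub_le _ _).trans (add_le_add ?_ ?_)
  · rw [norm_smul]
    exact mul_le_mul_of_nonneg_right (abs_kernel_le hB _ _) (norm_nonneg _)
  · exact norm_grad₂_le hB hk _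

include hk in
theorem sum_sq_norm_drift_le {x : Fin N → E d} {r : ℝ}
    (hr : (N : ℝ)⁻¹ * ∑ j, ‖gradient V (x j)‖ ^ 2 ≤ r ^ 2) :
    ∑ i, ‖drift k V x i‖ ^ 2 ≤ N * (2 * B ^ 2 * (r ^ 2 + d)) := by
  rcases Nat.eq_zero_or_pos N with rfl | hN
  · simp
  have hN' : (N : ℝ) ≠ 0 := Nat.cast_ne_zero.mpr hN.ne'
  have h : ∀ i, ‖drift k V x i‖ ^ 2 ≤ 2 * B ^ 2 * (r ^ 2 + d) := by
    intro i
    calc ‖drift k V x i‖ ^ 2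
        ≤ ((N : ℝ)⁻¹ * ∑ j, (B * ‖gradient V (x j)‖ + B * √(d : ℝ))) ^ 2 :=
          pow_le_pow_left₀ (norm_nonneg _) (norm_drift_le hk hB x i) 2
      _ ≤ (N : ℝ)⁻¹ * ∑ j, (B * ‖gradient V (x j)‖ + B * √(d : ℝ)) ^ 2 := sq_average_le _
      _ ≤ (N : ℝ)⁻¹ * ∑ j, (2 * B ^ 2 * ‖gradient V (x j)‖ ^ 2 + 2 * B ^ 2 * d) := by
          gcongr with j
          have hd : √(d : ℝ) ^ 2 = d := Real.sq_sqrt (Nat.cast_nonneg d)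
          have : (0 : ℝ) ≤ B ^ 2 * (‖gradient V (x j)‖ - √(d : ℝ)) ^ 2 := by positivity
          nlinarith
      _ = 2 * B ^ 2 * ((N : ℝ)⁻¹ * ∑ j, ‖gradient V (x j)‖ ^ 2 + d) := by
          rw [Finset.sum_add_distrib, ← Finset.mul_sum]
          simp only [Finset.sum_const, Finset.card_univ, Fintype.card_fin, nsmul_eq_mul]
          field_simp
      _ ≤ _ := by gcongr
  calc _ ≤ ∑ _i : Fin N, 2 * B ^ 2 * (r ^ 2 + d) := Finset.sum_le_sum fun i _ => h i
    _ = _ := by simp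

include hC in
-- The constants `β₁`, `β₂` stay free so that the estimate serves both general vectors and
-- coordinate vectors, for which better kernel bounds hold.
theorem sum_sq_norm_driftD_le (x u : Fin N → E d) {t : Fin N → ℝ} {β₁ β₂ : ℝ}
    (hu : ∀ i, ‖u i‖ ≤ t i)
    (h₁ : ∀ i j, |kerD k (x i, x j) (u i, u j)| ≤ β₁ * (t i + t j))
    (h₂ : ∀ i j, ‖fderiv ℝ (grad₂ k) (x i, x j) (u i, u j)‖ ≤ β₂ * (t i + t j)) :
    ∑ i, ‖driftD k V x u i‖ ^ 2 ≤
      4 * ((N : ℝ)⁻¹ * ∑ j, (β₁ * ‖gradient V (x j)‖ + β₂ + B * C) ^ 2) * ∑ i, t i ^ 2 := by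
  have hB0 : 0 ≤ B := (abs_nonneg _).trans (abs_kernel_le hB 0 0)
  have hC0 : 0 ≤ C := (norm_nonneg _).trans (hC 0)
  have ht : ∀ i, 0 ≤ t i := fun i => (norm_nonneg _).trans (hu i)
  refine le_trans (Finset.sum_le_sum fun i _ => ?_) (sum_sq_average_add_le _ _)
  refine pow_le_pow_left₀ (norm_nonneg _) ?_ 2
  rw [driftD_apply, norm_smul, Real.norm_of_nonneg (by positivity)]
  refine mul_le_mul_of_nonneg_left ((norm_sum_le _ _).trans ?_) (by positivity)
  refine Finset.sum_le_sum fun j _ => (norm_sub_le _ _).trans ?_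
  have e1 : ‖k (x i) (x j) • hessian V (x j) (u j)‖ ≤ B * C * (t i + t j) := by
    rw [norm_smul, mul_assoc]
    refine mul_le_mul (abs_kernel_le hB _ _) ?_ (norm_nonneg _) hB0
    calc _ ≤ ‖hessian V (x j)‖ * ‖u j‖ := ContinuousLinearMap.le_opNorm _ _
      _ ≤ C * (t i + t j) :=
        mul_le_mul (hC _) ((hu j).trans (le_add_of_nonneg_left (ht i))) (norm_nonneg _) hC0
  have e2 : ‖kerD k (x i, x j) (u i, u j) • gradient V (x j)‖
      ≤ β₁ * (t i + t j) * ‖gradient V (x j)‖ := by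
    rw [norm_smul]
    exact mul_le_mul_of_nonneg_right (h₁ i j) (norm_nonneg _)
  have e3 := norm_add_le (k (x i) (x j) • hessian V (x j) (u j))
    (kerD k (x i, x j) (u i, u j) • gradient V (x j))
  linarith [h₂ i j]

omit hB in
theorem average_sq_le (β₁ β₂ β₃ : ℝ) (z : Fin N → ℝ) {r : ℝ} (hN : 0 < N)
    (hr : (N : ℝ)⁻¹ * ∑ j, z j ^ 2 ≤ r ^ 2) :
    (N : ℝ)⁻¹ * ∑ j, (β₁ * z j + β₂ + β₃) ^ 2 ≤ 3 * (β₁ ^ 2 * r ^ 2 + β₂ ^ 2 + β₃ ^ 2) := by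
  have hN' : (N : ℝ) ≠ 0 := Nat.cast_ne_zero.mpr hN.ne'
  calc _ ≤ (N : ℝ)⁻¹ * ∑ j, (3 * β₁ ^ 2 * z j ^ 2 + (3 * β₂ ^ 2 + 3 * β₃ ^ 2)) := by
        gcongr with j
        nlinarith [sq_nonneg (β₁ * z j - β₂), sq_nonneg (β₁ * z j - β₃), sq_nonneg (β₂ - β₃)]
    _ = 3 * β₁ ^ 2 * ((N : ℝ)⁻¹ * ∑ j, z j ^ 2) + (3 * β₂ ^ 2 + 3 * β₃ ^ 2) := by
        rw [Finset.sum_add_distrib, ← Finset.mul_sum]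
        simp only [Finset.sum_const, Finset.card_univ, Fintype.card_fin, nsmul_eq_mul]
        field_simp
    _ ≤ 3 * β₁ ^ 2 * r ^ 2 + (3 * β₂ ^ 2 + 3 * β₃ ^ 2) := by gcongr
    _ = _ := by ring

include hk hC

theorem sum_sq_norm_driftD_apply_le (hN : 0 < N) {x : Fin N → E d} {r : ℝ}
    (hr : (N : ℝ)⁻¹ * ∑ j, ‖gradient V (x j)‖ ^ 2 ≤ r ^ 2) (u : Fin N → E d) :
    ∑ i, ‖driftD k V x u i‖ ^ 2 ≤ 12 * B ^ 2 * (d * r ^ 2 + d ^ 2 + C ^ 2) * ∑ i, ‖u i‖ ^ 2 := by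
  refine (sum_sq_norm_driftD_le (β₁ := B * √(d : ℝ)) (β₂ := B * d) hB hC x u (fun i => le_rfl)
    (fun i j => abs_kerD_le hB _ _ _) (fun i j => norm_fderiv_grad₂_le hB hk _ _ _)).trans ?_
  refine mul_le_mul_of_nonneg_right ?_ (Finset.sum_nonneg fun i _ => sq_nonneg _)
  have h := average_sq_le (B * √(d : ℝ)) (B * d) (B * C) _ hN hr
  have hd : √(d : ℝ) ^ 2 = d := Real.sq_sqrt (Nat.cast_nonneg d)
  rw [mul_pow, hd] at h
  linarith

/-- The Hilbert–Schmidt norm is summed over the `N d` columns. Inserting the operator bound for each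
column would give `d r² + d²` in place of `r² + d`. -/
theorem sum_sq_norm_driftD_unitVec_le (hN : 0 < N) {x : Fin N → E d} {r : ℝ}
    (hr : (N : ℝ)⁻¹ * ∑ j, ‖gradient V (x j)‖ ^ 2 ≤ r ^ 2) :
    ∑ l, ∑ m, ∑ i, ‖driftD k V x (unitVec l m) i‖ ^ 2
      ≤ 12 * N * d * B ^ 2 * (r ^ 2 + d + C ^ 2) := by
  have hcol : ∀ l m, ∑ i, ‖driftD k V x (unitVec l m) i‖ ^ 2
      ≤ 12 * B ^ 2 * (r ^ 2 + d + C ^ 2) := by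
    intro l m
    have hB0 : 0 ≤ B := (abs_nonneg _).trans (abs_kernel_le hB 0 0)
    have hvec : ∀ i, unitVec l m i = if i = l then (EuclideanSpace.single m 1 : E d) else 0 := by
      intro i
      simp [unitVec, Pi.single_apply]
    have hpair : ∀ i j, (unitVec l m i, unitVec l m j)
        = (if i = l then (1 : ℝ) else 0) • coordDir d (.inl m)
          + (if j = l then (1 : ℝ) else 0) • coordDir d (.inr m) := by
      intro i j
      rw [hvec, hvec]
      split_ifs <;> simp [coordDir]
    have hind : ∀ i, 0 ≤ if i = l then (1 : ℝ) else 0 := fun i => by split_ifs <;> norm_num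
    refine (sum_sq_norm_driftD_le (β₁ := B) (β₂ := B * √(d : ℝ))
      (t := fun i => if i = l then 1 else 0) hB hC x _ (fun i => ?_)
      (fun i j => ?_) (fun i j => ?_)).trans ?_
    · rw [hvec]; split_ifs <;> simp
    · rw [hpair, map_add, map_smul, map_smul, mul_add]
      refine (abs_add_le _ _).trans (add_le_add ?_ ?_)
      all_goals
        rw [smul_eq_mul, abs_mul, abs_of_nonneg (hind _), mul_comm]
        exact mul_le_mul_of_nonneg_right (abs_kerD_coordDir_le hB _ _) (hind _)
    · rw [hpair, map_add, map_smul, map_smul, mul_add]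
      refine (norm_add_le _ _).trans (add_le_add ?_ ?_)
      all_goals
        rw [norm_smul, Real.norm_of_nonneg (hind _), mul_comm]
        exact mul_le_mul_of_nonneg_right (norm_fderiv_grad₂_coordDir_le hB hk _ _) (hind _)
    · have h := average_sq_le B (B * √(d : ℝ)) (B * C) _ hN hr
      have hd : √(d : ℝ) ^ 2 = d := Real.sq_sqrt (Nat.cast_nonneg d)
      rw [mul_pow B, hd] at h
      simp only [ite_pow, one_pow, ne_eq, OfNat.ofNat_ne_zero, not_false_eq_true, zero_pow,
        Finset.sum_ite_eq', Finset.mem_univ, if_true, mul_one]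
      linarith
  calc _ ≤ ∑ _l : Fin N, ∑ _m : Fin d, 12 * B ^ 2 * (r ^ 2 + d + C ^ 2) :=
        Finset.sum_le_sum fun l _ => Finset.sum_le_sum fun m _ => hcol l m
    _ = _ := by
        simp only [Finset.sum_const, Finset.card_univ, Fintype.card_fin, nsmul_eq_mul]
        ring

include hV

/-- The difference is split so that `∇V` itself is evaluated only at `x`; nothing is asked of `y`.
Hence a step separates a controlled configuration from every other one. -/
theorem norm_drift_sub_le (hN : 0 < N) {x : Fin N → E d} {r : ℝ} (hr0 : 0 ≤ r)
    (hr : (N : ℝ)⁻¹ * ∑ j, ‖gradient V (x j)‖ ^ 2 ≤ r ^ 2) (y : Fin N → E d) :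
    ‖drift k V x - drift k V y‖ ≤ (2 * B * √(d : ℝ) * r + 2 * B * d + B * C) * ‖x - y‖ := by
  have hB0 : 0 ≤ B := (abs_nonneg _).trans (abs_kernel_le hB 0 0)
  have hC0 : 0 ≤ C := (norm_nonneg _).trans (hC 0)
  have hN' : (N : ℝ) ≠ 0 := Nat.cast_ne_zero.mpr hN.ne'
  have hs : ∀ i, ‖x i - y i‖ ≤ ‖x - y‖ := fun i => norm_le_pi_norm (x - y) i
  refine (pi_norm_le_iff_of_nonneg (by positivity)).mpr fun i => ?_
  have hterm : ∀ j, ‖(k (x i) (x j) • gradient V (x j) - grad₂ k (x i, x j))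
      - (k (y i) (y j) • gradient V (y j) - grad₂ k (y i, y j))‖
      ≤ (2 * B * √(d : ℝ) * ‖gradient V (x j)‖ + (2 * B * d + B * C)) * ‖x - y‖ := by
    intro j
    have e : (k (x i) (x j) • gradient V (x j) - grad₂ k (x i, x j))
      - (k (y i) (y j) • gradient V (y j) - grad₂ k (y i, y j))
      = (k (x i) (x j) - k (y i) (y j)) • gradient V (x j)
        + k (y i) (y j) • (gradient V (x j) - gradient V (y j))
        - (grad₂ k (x i, x j) - grad₂ k (y i, y j)) := by module
    have e1 : ‖(k (x i) (x j) - k (y i) (y j)) • gradient V (x j)‖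
        ≤ B * √(d : ℝ) * (‖x - y‖ + ‖x - y‖) * ‖gradient V (x j)‖ := by
      rw [norm_smul]
      refine mul_le_mul_of_nonneg_right ?_ (norm_nonneg _)
      refine (abs_kernel_sub_le hB hk _ _ _ _).trans ?_
      gcongr <;> exact hs _
    have e2 : ‖k (y i) (y j) • (gradient V (x j) - gradient V (y j))‖ ≤ B * (C * ‖x - y‖) := by
      rw [norm_smul]
      refine mul_le_mul (abs_kernel_le hB _ _) ?_ (norm_nonneg _) hB0
      refine (norm_gradient_sub_le hV hC _ _).trans ?_
      gcongr; exact hs _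
    have e3 : ‖grad₂ k (x i, x j) - grad₂ k (y i, y j)‖ ≤ B * d * (‖x - y‖ + ‖x - y‖) := by
      refine (norm_grad₂_sub_le hB hk _ _ _ _).trans ?_
      gcongr <;> exact hs _
    rw [e]
    refine (norm_sub_le _ _).trans ?_
    have e4 := norm_add_le ((k (x i) (x j) - k (y i) (y j)) • gradient V (x j))
      (k (y i) (y j) • (gradient V (x j) - gradient V (y j)))
    linarith
  rw [Pi.sub_apply, drift, drift, ← smul_sub, ← Finset.sum_sub_distrib, norm_smul,
    Real.norm_of_nonneg (by positivity)]
  calc _ ≤ (N : ℝ)⁻¹ * ∑ j, (2 * B * √(d : ℝ) * ‖gradient V (x j)‖ + (2 * B * d + B * C))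
          * ‖x - y‖ := by
        refine mul_le_mul_of_nonneg_left ((norm_sum_le _ _).trans ?_) (by positivity)
        exact Finset.sum_le_sum fun j _ => hterm j
    _ = (2 * B * √(d : ℝ) * ((N : ℝ)⁻¹ * ∑ j, ‖gradient V (x j)‖) + 2 * B * d + B * C)
          * ‖x - y‖ := by
        rw [← Finset.sum_mul, Finset.sum_add_distrib, ← Finset.mul_sum]
        simp only [Finset.sum_const, Finset.card_univ, Fintype.card_fin, nsmul_eq_mul]
        field_simp
        ring
    _ ≤ _ := by
        gcongr
        exact average_le_of_average_sq_le hr0 hr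

theorem eq_of_step_eq (hN : 0 < N) {η : ℝ} (hη : 0 ≤ η) {x y : Fin N → E d} {r : ℝ} (hr0 : 0 ≤ r)
    (hr : (N : ℝ)⁻¹ * ∑ j, ‖gradient V (x j)‖ ^ 2 ≤ r ^ 2)
    (hsmall : η * (2 * B * √(d : ℝ) * r + 2 * B * d + B * C) < 1)
    (h : step k V η x = step k V η y) : x = y := by
  rw [step_eq, step_eq] at h
  have e : x - y = η • (drift k V x - drift k V y) := by
    rw [smul_sub, sub_eq_sub_iff_sub_eq_sub]; exact h
  by_contra hxy
  have hpos : 0 < ‖x - y‖ := norm_pos_iff.mpr (sub_ne_zero.mpr hxy)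
  have h1 : ‖x - y‖ ≤ η * ((2 * B * √(d : ℝ) * r + 2 * B * d + B * C) * ‖x - y‖) := by
    conv_lhs => rw [e, norm_smul, Real.norm_of_nonneg hη]
    exact mul_le_mul_of_nonneg_left (norm_drift_sub_le hk hV hB hC hN hr0 hr y) hη
  nlinarith

/-- The total potential decreases along one iteration up to the drift. -/
theorem sum_potential_step_le {η : ℝ} {x : Fin N → E d} {r : ℝ}
    (hr : (N : ℝ)⁻¹ * ∑ j, ‖gradient V (x j)‖ ^ 2 ≤ r ^ 2) :
    ∑ i, V (step k V η x i) ≤ ∑ i, V (x i) - η * ∑ i, inner ℝ (gradient V (x i)) (drift k V x i)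
      + η ^ 2 * (N * (2 * C * B ^ 2 * (r ^ 2 + d))) := by
  have hC0 : 0 ≤ C := (norm_nonneg _).trans (hC 0)
  have h1 : ∀ i, V (step k V η x i) ≤ V (x i)
      - η * inner ℝ (gradient V (x i)) (drift k V x i) + C * (η ^ 2 * ‖drift k V x i‖ ^ 2) := by
    intro i
    have h := potential_sub_le hV hC (x i) (η • drift k V x i)
    rw [real_inner_smul_right, norm_smul, mul_pow, Real.norm_eq_abs, sq_abs] at h
    rw [step_eq]
    exact h
  calc _ ≤ ∑ i, (V (x i)
      - η * inner ℝ (gradient V (x i)) (drift k V x i) + C * (η ^ 2 * ‖drift k V x i‖ ^ 2)) :=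
        Finset.sum_le_sum fun i _ => h1 i
    _ = ∑ i, V (x i) - η * ∑ i, inner ℝ (gradient V (x i)) (drift k V x i)
        + C * (η ^ 2 * ∑ i, ‖drift k V x i‖ ^ 2) := by
        rw [Finset.sum_add_distrib, Finset.sum_sub_distrib]
        simp only [Finset.mul_sum]
    _ ≤ ∑ i, V (x i) - η * ∑ i, inner ℝ (gradient V (x i)) (drift k V x i)
        + C * (η ^ 2 * (N * (2 * B ^ 2 * (r ^ 2 + d)))) := by
        gcongr
        exact sum_sq_norm_drift_le hk hB hr
    _ = _ := by ring

/-- The quadratic part of `∑ ∇V · drift` is nonnegative because `k` is positive definite. Only the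
repulsion `∇₂k` can raise the potential at first order, so the growth is linear in `r`, not
quadratic. -/
theorem average_potential_step_le (hpd : (Matrix.of k).PosSemidef) (hN : 0 < N) {η : ℝ}
    (hη : 0 ≤ η) {x : Fin N → E d} {r : ℝ} (hr0 : 0 ≤ r)
    (hr : (N : ℝ)⁻¹ * ∑ j, ‖gradient V (x j)‖ ^ 2 ≤ r ^ 2) :
    (N : ℝ)⁻¹ * ∑ i, V (step k V η x i) ≤ (N : ℝ)⁻¹ * ∑ i, V (x i)
      + η * (B * √(d : ℝ) * r) + η ^ 2 * (2 * C * B ^ 2 * (r ^ 2 + d)) := by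
  have hB0 : 0 ≤ B := (abs_nonneg _).trans (abs_kernel_le hB 0 0)
  have hN' : (N : ℝ) ≠ 0 := Nat.cast_ne_zero.mpr hN.ne'
  have hdrift : -(B * √(d : ℝ) * (N * r)) ≤
      ∑ i, inner ℝ (gradient V (x i)) (drift k V x i) := by
    have h1 : ∑ i, inner ℝ (gradient V (x i)) (drift k V x i) = (N : ℝ)⁻¹ *
        (∑ i, ∑ j, k (x i) (x j) * inner ℝ (gradient V (x i)) (gradient V (x j))
        - ∑ i, ∑ j, inner ℝ (gradient V (x i)) (grad₂ k (x i, x j))) := by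
      rw [← Finset.sum_sub_distrib, Finset.mul_sum]
      refine Finset.sum_congr rfl fun i _ => ?_
      simp only [drift, real_inner_smul_right, inner_sum, inner_sub_right,
        Finset.sum_sub_distrib]
    have h2 := sum_inner_mul_kernel_nonneg hpd x fun i => gradient V (x i)
    have h3 : ∑ i, ∑ j, inner ℝ (gradient V (x i)) (grad₂ k (x i, x j))
        ≤ N * (B * √(d : ℝ) * (N * r)) := by
      calc _ ≤ ∑ i, ∑ _j : Fin N, ‖gradient V (x i)‖ * (B * √(d : ℝ)) := by
            refine Finset.sum_le_sum fun i _ => Finset.sum_le_sum fun j _ => ?_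
            refine (real_inner_le_norm _ _).trans ?_
            gcongr
            exact norm_grad₂_le hB hk _
        _ = N * (B * √(d : ℝ) * (N * ((N : ℝ)⁻¹ * ∑ i, ‖gradient V (x i)‖))) := by
            simp only [Finset.sum_const, Finset.card_univ, Fintype.card_fin, nsmul_eq_mul]
            rw [← Finset.mul_sum, ← Finset.sum_mul]
            field_simp
        _ ≤ _ := by
            gcongr
            exact average_le_of_average_sq_le hr0 hr
    rw [h1]
    calc -(B * √(d : ℝ) * (N * r)) = (N : ℝ)⁻¹ * (0 - N * (B * √(d : ℝ) * (N * r))) := by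
          field_simp; ring
      _ ≤ _ := by gcongr
  have h := sum_potential_step_le hk hV hB hC (η := η) hr
  calc _ ≤ (N : ℝ)⁻¹ * (∑ i, V (x i) - η * (-(B * √(d : ℝ) * (N * r)))
      + η ^ 2 * (N * (2 * C * B ^ 2 * (r ^ 2 + d)))) := by
        gcongr
        refine h.trans ?_
        gcongr
    _ = _ := by field_simp; ring

/-- The pathwise entropy dissipation inequality for one iteration. -/
theorem ksdSq_le_log_jacobian (hN : 0 < N) {η : ℝ} (hη : 0 ≤ η) {x : Fin N → E d} {r c : ℝ}
    (hr : (N : ℝ)⁻¹ * ∑ j, ‖gradient V (x j)‖ ^ 2 ≤ r ^ 2)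
    (hsmall : η ^ 2 * (12 * B ^ 2 * (d * r ^ 2 + d ^ 2 + C ^ 2)) ≤ 1 / 4)
    (hc : ∀ z, Cstar k V z ≤ c) :
    (fderiv ℝ (step k V η) x).det ≠ 0 ∧
    η * N * ksdSq k V x - η * c
      - η ^ 2 * (N * B ^ 2 * (2 * C * (r ^ 2 + d) + 48 * d * (r ^ 2 + d + C ^ 2)))
      ≤ ∑ i, V (x i) - ∑ i, V (step k V η x i)
        + Real.log |(fderiv ℝ (step k V η) x).det| := by
  have hN' : (N : ℝ) ≠ 0 := Nat.cast_ne_zero.mpr hN.ne'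
  rw [(hasFDerivAt_step hk hV η x).fderiv]
  have hL : ∀ u, ∑ i, ‖(η • driftD k V x) u i‖ ^ 2 ≤ (1 / 4) * ∑ i, ‖u i‖ ^ 2 := by
    intro u
    have h := sum_sq_norm_driftD_apply_le hk hB hC hN hr u
    calc _ = η ^ 2 * ∑ i, ‖driftD k V x u i‖ ^ 2 := by
          rw [Finset.mul_sum]
          refine Finset.sum_congr rfl fun i _ => ?_
          rw [smul_apply, Pi.smul_apply, norm_smul, mul_pow,
            Real.norm_eq_abs, sq_abs]
      _ ≤ η ^ 2 * (12 * B ^ 2 * (d * r ^ 2 + d ^ 2 + C ^ 2) * ∑ i, ‖u i‖ ^ 2) := by gcongr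
      _ = η ^ 2 * (12 * B ^ 2 * (d * r ^ 2 + d ^ 2 + C ^ 2)) * ∑ i, ‖u i‖ ^ 2 := by ring
      _ ≤ _ := by gcongr
  obtain ⟨hdet, hlog⟩ := det_id_sub_ne_zero_and_neg_log_le hL
  refine ⟨hdet, ?_⟩
  have e1 : ∑ i, ∑ m, (η • driftD k V x) (unitVec i m) i m
      = η * ∑ i, ∑ m, driftD k V x (unitVec i m) i m := by
    simp [Finset.mul_sum]
  have e2 : ∑ l, ∑ m, ∑ i, ‖(η • driftD k V x) (unitVec l m) i‖ ^ 2
      = η ^ 2 * ∑ l, ∑ m, ∑ i, ‖driftD k V x (unitVec l m) i‖ ^ 2 := by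
    simp only [Finset.mul_sum, smul_apply, Pi.smul_apply, norm_smul, mul_pow,
      Real.norm_eq_abs, sq_abs]
  rw [e1, e2] at hlog
  -- The first order decrease of the potential and the trace in the determinant bound combine
  -- through this identity; the coefficient `48` is `4 · 12` from the Hilbert–Schmidt term.
  have h1 := inner_gradient_drift_sub_trace hk hV x
  have h2 := sum_potential_step_le hk hV hB hC (η := η) hr
  have h3 := mul_le_mul_of_nonneg_left (sum_sq_norm_driftD_unitVec_le hk hB hC hN hr) (sq_nonneg η)
  have h4 : (N : ℝ)⁻¹ * ∑ i, Cstar k V (x i) ≤ c := by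
    calc _ ≤ (N : ℝ)⁻¹ * ∑ _i : Fin N, c := by gcongr; exact hc _
      _ = c := by simp; field_simp
  have h5 : η * (∑ i, inner ℝ (gradient V (x i)) (drift k V x i)
      - ∑ i, ∑ m, driftD k V x (unitVec i m) i m) ≥ η * (N * ksdSq k V x - c) := by
    rw [h1]; gcongr
  linarith

end Estimates

end Drift

end SVGD

namespace SVGD

/-! ### The variational inequality for relative entropy. -/

section Entropy

open InformationTheory

/-- Young's inequality for the Legendre pair `t log t - t` and `exp s`; recall `klFun t = t log t +
1 - t`. -/
theorem mul_le_klFun_add_exp {t : ℝ} (ht : 0 ≤ t) (s : ℝ) :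
    t * s ≤ klFun t - 1 + Real.exp s := by
  rw [klFun_apply]
  rcases ht.eq_or_lt with rfl | ht
  · simp [Real.exp_nonneg]
  · have h := Real.add_one_le_exp (s - Real.log t)
    rw [Real.exp_sub, Real.exp_log ht, le_div_iff₀ ht] at h
    nlinarith

/-- The entropy inequality: a truncated form of the Donsker–Varadhan bound. -/
theorem setLIntegral_le_klDiv_add {α : Type*} [MeasurableSpace α] {p ν : Measure α}
    [IsProbabilityMeasure p] [IsFiniteMeasure ν] (hp : klDiv p ν ≠ ∞) {S : Set α}
    (hS : MeasurableSet S) {u : α → ℝ} (hu : Measurable u) {c : ℝ} (hc : 0 ≤ c) :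
    ∫⁻ x in S, ENNReal.ofReal (u x) ∂p ≤
      klDiv p ν + ENNReal.ofReal c + ∫⁻ x in S, ENNReal.ofReal (Real.exp (u x - c)) ∂ν := by
  have hac : p ≪ ν := (klDiv_ne_top_iff.mp hp).1
  rw [klDiv_eq_lintegral_klFun_of_ac hac,
    ← setLIntegral_rnDeriv_mul hac hu.ennreal_ofReal.aemeasurable hS]
  have hfin : ∀ᵐ x ∂ν.restrict S, p.rnDeriv ν x < ∞ :=
    ae_restrict_of_ae (Measure.rnDeriv_lt_top p ν)
  calc ∫⁻ x in S, p.rnDeriv ν x * ENNReal.ofReal (u x) ∂ν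
      ≤ ∫⁻ x in S, (ENNReal.ofReal (klFun (p.rnDeriv ν x).toReal)
          + ENNReal.ofReal c * p.rnDeriv ν x) + ENNReal.ofReal (Real.exp (u x - c)) ∂ν := by
        refine lintegral_mono_ae ?_
        filter_upwards [hfin] with x hx
        obtain ⟨t, ht⟩ : ∃ t : ℝ, t = (p.rnDeriv ν x).toReal := ⟨_, rfl⟩
        have ht0 : 0 ≤ t := ht ▸ ENNReal.toReal_nonneg
        have e : p.rnDeriv ν x = ENNReal.ofReal t := by rw [ht, ENNReal.ofReal_toReal hx.ne]
        rw [e, ENNReal.toReal_ofReal ht0, ← ENNReal.ofReal_mul ht0, ← ENNReal.ofReal_mul hc,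
          ← ENNReal.ofReal_add (klFun_nonneg ht0) (by positivity),
          ← ENNReal.ofReal_add (add_nonneg (klFun_nonneg ht0) (by positivity))
            (Real.exp_nonneg _)]
        refine ENNReal.ofReal_le_ofReal ?_
        have := mul_le_klFun_add_exp ht0 (u x - c)
        linarith
    _ = (∫⁻ x in S, ENNReal.ofReal (klFun (p.rnDeriv ν x).toReal) ∂ν
          + ENNReal.ofReal c * ∫⁻ x in S, p.rnDeriv ν x ∂ν)
          + ∫⁻ x in S, ENNReal.ofReal (Real.exp (u x - c)) ∂ν := by
        have hm := Measure.measurable_rnDeriv p ν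
        have hm1 : Measurable fun x => ENNReal.ofReal (klFun (p.rnDeriv ν x).toReal) :=
          (measurable_klFun.comp hm.ennreal_toReal).ennreal_ofReal
        have hm2 : Measurable fun x => ENNReal.ofReal (klFun (p.rnDeriv ν x).toReal)
            + ENNReal.ofReal c * p.rnDeriv ν x := hm1.add (hm.const_mul _)
        rw [lintegral_add_left hm2, lintegral_add_left hm1,
          lintegral_const_mul _ hm]
    -- Since `klFun` is nonnegative on `[0, ∞)`, enlarging its domain from `S` to the whole space
    -- only increases the integral, and `p S ≤ 1` handles the constant.
    _ ≤ _ := by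
        gcongr
        · exact Measure.restrict_le_self
        · refine (mul_le_of_le_one_right zero_le ?_)
          rw [Measure.setLIntegral_rnDeriv hac]
          exact prob_le_one

end Entropy

/-! ### The pullback of the product target under an injective map. -/

section ChangeOfVariables

variable {d N : ℕ} {V : E d → ℝ}

theorem isProbabilityMeasure_target (hint : Integrable fun x => Real.exp (-V x)) :
    IsProbabilityMeasure (target V) :=
  isProbabilityMeasure_tilted hint

theorem pi_target_eq_withDensity (hint : Integrable fun x => Real.exp (-V x)) :
    Measure.pi (fun _ : Fin N => target V) = volume.withDensity fun x : Fin N → E d =>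
      ENNReal.ofReal (Real.exp (-∑ i, V (x i)) / (∫ y, Real.exp (-V y)) ^ N) := by
  have := isProbabilityMeasure_target hint
  refine Measure.pi_eq fun s hs => ?_
  have hprod : ∀ x : Fin N → E d, Real.exp (-∑ i, V (x i)) / (∫ y, Real.exp (-V y)) ^ N
      = ∏ i, Real.exp (-V (x i)) / ∫ y, Real.exp (-V y) := by
    intro x
    rw [Finset.prod_div_distrib, ← Real.exp_sum, Finset.sum_neg_distrib]
    simp
  have hpos : 0 ≤ ∫ y, Real.exp (-V y) := integral_nonneg fun y => (Real.exp_pos _).le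
  rw [withDensity_apply _ (MeasurableSet.univ_pi hs)]
  simp only [hprod]
  rw [volume_pi, Measure.restrict_pi_pi, ← ofReal_integral_eq_lintegral_ofReal,
    integral_fintype_prod_eq_prod (𝕜 := ℝ) (f := fun _ y => Real.exp (-V y) / ∫ y, Real.exp (-V y)),
    ENNReal.ofReal_prod_of_nonneg]
  · exact Finset.prod_congr rfl fun i _ => by rw [target, tilted_apply_eq_ofReal_integral]
  · exact fun i _ => integral_nonneg fun y => div_nonneg (Real.exp_pos _).le hpos
  · exact Integrable.fintype_prod (f := fun _ y => Real.exp (-V y) / ∫ y, Real.exp (-V y))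
      fun i => (hint.div_const _).integrableOn
  · exact Filter.Eventually.of_forall fun x =>
      Finset.prod_nonneg fun i _ => div_nonneg (Real.exp_pos _).le hpos

/-- After multiplication by the density of `π^{⊗N}`, the integrand is `|det DF|` times that density
at `F x`. The integral is therefore the `π^{⊗N}`-mass of `F '' S`. -/
theorem setLIntegral_exp_mul_abs_det_le_one (hV : Continuous V)
    (hint : Integrable fun x => Real.exp (-V x))
    {F : (Fin N → E d) → Fin N → E d} {S : Set (Fin N → E d)} (hS : MeasurableSet S)
    (hF : Differentiable ℝ F) (hinj : Set.InjOn F S) :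
    ∫⁻ x in S, ENNReal.ofReal (Real.exp (∑ i, V (x i) - ∑ i, V (F x i)) * |(fderiv ℝ F x).det|)
      ∂Measure.pi (fun _ : Fin N => target V) ≤ 1 := by
  have := isProbabilityMeasure_target hint
  have hpos : 0 ≤ ∫ y, Real.exp (-V y) := integral_nonneg fun y => (Real.exp_pos _).le
  have hpi := pi_target_eq_withDensity (N := N) hint
  set ρ : (Fin N → E d) → ℝ≥0∞ := fun x =>
    ENNReal.ofReal (Real.exp (-∑ i, V (x i)) / (∫ y, Real.exp (-V y)) ^ N) with hρ
  have hρm : Measurable ρ := by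
    refine Measurable.ennreal_ofReal (Continuous.measurable ?_)
    fun_prop
  have huniv : ∫⁻ x, ρ x = 1 := by
    rw [← setLIntegral_univ, ← withDensity_apply _ MeasurableSet.univ, ← hpi, measure_univ]
  rw [hpi, setLIntegral_withDensity_eq_setLIntegral_mul_non_measurable _ hρm _ hS
    (Filter.Eventually.of_forall fun x => ENNReal.ofReal_lt_top)]
  have e : ∀ x, (ρ * fun x => ENNReal.ofReal
      (Real.exp (∑ i, V (x i) - ∑ i, V (F x i)) * |(fderiv ℝ F x).det|)) x
      = ENNReal.ofReal |(fderiv ℝ F x).det| * ρ (F x) := by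
    intro x
    simp only [hρ, Pi.mul_apply]
    rw [← ENNReal.ofReal_mul (by positivity), ← ENNReal.ofReal_mul (abs_nonneg _)]
    congr 1
    rw [sub_eq_add_neg, Real.exp_add, Real.exp_neg (∑ i, V (x i))]
    have := Real.exp_ne_zero (∑ i, V (x i))
    field_simp
  simp only [e]
  rw [← lintegral_image_eq_lintegral_abs_det_fderiv_mul volume hS
    (fun x _ => (hF x).hasFDerivAt.hasFDerivWithinAt) hinj, ← huniv]
  exact setLIntegral_le_lintegral _ _

end ChangeOfVariables

/-! ### Control along trajectories and the accumulated entropy bound. -/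

section Trajectory

variable {d N : ℕ} {k : E d → E d → ℝ} {V : E d → ℝ}

/-- Backward induction in time. Leaving `y` arbitrary means that only the trajectory of `x` has to
be controlled. -/
theorem injOn_iterate {X : Type*} {f : X → X} {S : Set X} {T : ℕ}
    (h : ∀ x ∈ S, ∀ n < T, ∀ y, f (f^[n] x) = f y → f^[n] x = y) : Set.InjOn f^[T] S := by
  intro x hx y _ hxy
  have key : ∀ n ≤ T, f^[n] x = f^[n] y → x = y := by
    intro n
    induction n with
    | zero => exact fun _ h => h
    | succ n ih =>
      intro hn h'
      rw [Function.iterate_succ_apply', Function.iterate_succ_apply'] at h'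
      exact ih (by omega) (h x hx n (by omega) _ h')
  exact key T le_rfl hxy

theorem sum_le_log_jacobian_iterate {X : Type*} [NormedAddCommGroup X] [NormedSpace ℝ X]
    {f : X → X} (hf : Differentiable ℝ f) {W Q : X → ℝ} {x : X} {T : ℕ}
    (h : ∀ n < T, (fderiv ℝ f (f^[n] x)).det ≠ 0 ∧
      Q (f^[n] x) ≤ W (f^[n] x) - W (f^[n + 1] x) + Real.log |(fderiv ℝ f (f^[n] x)).det|) :
    (fderiv ℝ f^[T] x).det ≠ 0 ∧ ∑ n ∈ Finset.range T, Q (f^[n] x)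
      ≤ W x - W (f^[T] x) + Real.log |(fderiv ℝ f^[T] x).det| := by
  induction T with
  | zero =>
    have h1 : (ContinuousLinearMap.id ℝ X).det = 1 := LinearMap.det_id
    simp [h1]
  | succ T ih =>
    obtain ⟨ih1, ih2⟩ := ih fun n hn => h n (by omega)
    obtain ⟨h1, h2⟩ := h T (by omega)
    have hdet : (fderiv ℝ f^[T + 1] x).det
        = (fderiv ℝ f (f^[T] x)).det * (fderiv ℝ f^[T] x).det := by
      rw [Function.iterate_succ', fderiv_comp x (hf _) (hf.iterate T x)]
      exact LinearMap.det_comp _ _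
    rw [hdet, abs_mul, Real.log_mul (abs_ne_zero.mpr h1) (abs_ne_zero.mpr ih1),
      Finset.sum_range_succ]
    exact ⟨mul_ne_zero h1 ih1, by linarith⟩

/-- Jensen's inequality for `t ↦ t^(2α)`, which is concave because `α ≤ 1/2`. -/
theorem average_gradient_sq_le (hN : 0 < N) {A α M : ℝ} (hα0 : 0 ≤ α)
    (hα : α ≤ 1 / 2) (hpos : ∀ x, 0 ≤ V x) (hgrad : ∀ x, ‖gradient V x‖ ≤ A * V x ^ α)
    {x : Fin N → E d} (hx : (N : ℝ)⁻¹ * ∑ i, V (x i) ≤ M) :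
    (N : ℝ)⁻¹ * ∑ j, ‖gradient V (x j)‖ ^ 2 ≤ (A * M ^ α) ^ 2 := by
  have hN' : (N : ℝ) ≠ 0 := Nat.cast_ne_zero.mpr hN.ne'
  have h0 : 0 ≤ (N : ℝ)⁻¹ * ∑ i, V (x i) :=
    mul_nonneg (by positivity) (Finset.sum_nonneg fun i _ => hpos _)
  have hsq : ∀ {y : ℝ}, 0 ≤ y → (y ^ α) ^ 2 = y ^ (2 * α) := by
    intro y hy
    rw [← Real.rpow_natCast, ← Real.rpow_mul hy]
    congr 1
    push_cast
    ring
  have hjensen : (N : ℝ)⁻¹ * ∑ j, V (x j) ^ (2 * α) ≤ ((N : ℝ)⁻¹ * ∑ i, V (x i)) ^ (2 * α) := by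
    have h := (Real.concaveOn_rpow (p := 2 * α) (by linarith) (by linarith)).le_map_sum
      (t := Finset.univ) (w := fun _ : Fin N => (N : ℝ)⁻¹) (p := fun j => V (x j))
      (fun _ _ => by positivity) (by simp [hN']) (fun j _ => hpos _)
    simpa [Finset.mul_sum] using h
  calc _ ≤ (N : ℝ)⁻¹ * ∑ j, A ^ 2 * V (x j) ^ (2 * α) := by
        gcongr with j
        rw [← hsq (hpos _), ← mul_pow]
        exact pow_le_pow_left₀ (norm_nonneg _) (hgrad _) 2
    _ = A ^ 2 * ((N : ℝ)⁻¹ * ∑ j, V (x j) ^ (2 * α)) := by rw [← Finset.mul_sum]; ring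
    _ ≤ A ^ 2 * M ^ (2 * α) := by
        gcongr
        exact hjensen.trans (Real.rpow_le_rpow h0 hx (by linarith))
    _ = _ := by rw [mul_pow, hsq (h0.trans hx)]

variable (hk : ContDiff ℝ 2 fun p : E d × E d => k p.1 p.2) (hV : ContDiff ℝ 2 V)
include hk hV

theorem continuous_ksdSq : Continuous (ksdSq (N := N) k V) := by
  have hg : Continuous (gradient V) := (contDiff_gradient hV).continuous
  have hD : Continuous (kerD k) := (contDiff_kerD hk).continuous
  have hD2 : Continuous (kerD2 k) := continuous_kerD2 hk
  have hkc : Continuous fun p : E d × E d => k p.1 p.2 := hk.continuous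
  have hst : Continuous fun p : E d × E d => steinKernel k V p.1 p.2 := by
    unfold steinKernel
    have h1 : Continuous fun p : E d × E d => gradient V p.1 := hg.comp continuous_fst
    have h2 : Continuous fun p : E d × E d => gradient V p.2 := hg.comp continuous_snd
    refine (((hkc.mul (h1.inner h2)).sub (hD.clm_apply (continuous_const.prodMk h1))).sub
      (hD.clm_apply (h2.prodMk continuous_const))).add ?_
    exact continuous_finsetSum _ fun l _ =>
      (hD2.clm_apply continuous_const).clm_apply continuous_const
  unfold ksdSq
  refine continuous_const.mul (continuous_finsetSum _ fun i _ =>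
    continuous_finsetSum _ fun j _ => ?_)
  exact Continuous.comp (g := fun p : E d × E d => steinKernel k V p.1 p.2)
    (f := fun x : Fin N → E d => (x i, x j)) hst ((continuous_apply i).prodMk (continuous_apply j))

variable (hpd : (Matrix.of k).PosSemidef) {B C : ℝ} (hB : KernelBoundedBy k B)
  (hC : ∀ x, ‖hessian V x‖ ≤ C)
include hpd hB hC

/-- Along the first `T` iterations started from `{w ≤ K}`, the average potential stays below `M`. -/
theorem average_potential_iterate_le (hN : 0 < N) {A α K M η : ℝ} {T : ℕ} (hη : 0 ≤ η)
    (hA : 0 ≤ A) (hα0 : 0 ≤ α) (hα : α ≤ 1 / 2) (hM : 0 ≤ M) (hpos : ∀ x, 0 ≤ V x)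
    (hgrad : ∀ x, ‖gradient V x‖ ≤ A * V x ^ α)
    (hgrow : K + T * (η * (B * √(d : ℝ) * (A * M ^ α))
      + η ^ 2 * (2 * C * B ^ 2 * ((A * M ^ α) ^ 2 + d))) ≤ M)
    {x : Fin N → E d} (hx : x ∈ sublevel N V K) {n : ℕ} (hn : n ≤ T) :
    (N : ℝ)⁻¹ * ∑ i, V ((step k V η)^[n] x i) ≤ M := by
  have hB0 : 0 ≤ B := (abs_nonneg _).trans (abs_kernel_le hB 0 0)
  have hC0 : 0 ≤ C := (norm_nonneg _).trans (hC 0)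
  have hr0 : 0 ≤ A * M ^ α := by positivity
  set δ := η * (B * √(d : ℝ) * (A * M ^ α)) + η ^ 2 * (2 * C * B ^ 2 * ((A * M ^ α) ^ 2 + d))
    with hδ
  have hδ0 : 0 ≤ δ := by positivity
  -- Bootstrap: linear growth up to time `n` stays below `M`, which validates the gradient bound
  -- used for step `n + 1`.
  have key : ∀ n ≤ T, (N : ℝ)⁻¹ * ∑ i, V ((step k V η)^[n] x i) ≤ K + n * δ := by
    intro n
    induction n with
    | zero => intro _; simpa [sublevel] using hx
    | succ n ih =>
      intro hn
      have h1 := ih (by omega)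
      have h2 : (N : ℝ)⁻¹ * ∑ i, V ((step k V η)^[n] x i) ≤ M := by
        refine (h1.trans ?_).trans hgrow
        have : (n : ℝ) ≤ T := by exact_mod_cast (by omega : n ≤ T)
        gcongr
      have h3 := average_potential_step_le hk hV hB hC hpd hN hη hr0
        (average_gradient_sq_le hN hα0 hα hpos hgrad h2)
      rw [Function.iterate_succ_apply']
      refine h3.trans ?_
      push_cast
      linarith
  refine ((key n hn).trans ?_).trans hgrow
  have : (n : ℝ) ≤ T := by exact_mod_cast hn
  gcongr

/-- The entropy bound on the accumulated kernelized Stein discrepancy. -/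
theorem setLIntegral_sum_ksdSq_le (hN : 0 < N) {A α K M η c : ℝ} {T : ℕ} (hη : 0 ≤ η)
    (hA : 0 ≤ A) (hα0 : 0 ≤ α) (hα : α ≤ 1 / 2) (hM : 0 ≤ M) (hpos : ∀ x, 0 ≤ V x)
    (hint : Integrable fun x => Real.exp (-V x))
    (hgrad : ∀ x, ‖gradient V x‖ ≤ A * V x ^ α) (hc0 : 0 ≤ c) (hc : ∀ z, Cstar k V z ≤ c)
    (hgrow : K + T * (η * (B * √(d : ℝ) * (A * M ^ α))
      + η ^ 2 * (2 * C * B ^ 2 * ((A * M ^ α) ^ 2 + d))) ≤ M)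
    (hinj : η * (2 * B * √(d : ℝ) * (A * M ^ α) + 2 * B * d + B * C) < 1)
    (hsmall : η ^ 2 * (12 * B ^ 2 * (d * (A * M ^ α) ^ 2 + d ^ 2 + C ^ 2)) ≤ 1 / 4)
    {p : Measure (Fin N → E d)} [IsProbabilityMeasure p]
    (hp : InformationTheory.klDiv p (Measure.pi fun _ => target V) ≠ ∞) :
    ∫⁻ x in sublevel N V K, ENNReal.ofReal
        (η * N * ∑ n ∈ Finset.range T, ksdSq k V ((step k V η)^[n] x)) ∂p
      ≤ InformationTheory.klDiv p (Measure.pi fun _ => target V)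
        + ENNReal.ofReal (T * (η * c + η ^ 2 * (N * B ^ 2 * (2 * C * ((A * M ^ α) ^ 2 + d)
          + 48 * d * ((A * M ^ α) ^ 2 + d + C ^ 2))))) + 1 := by
  have hC0 : 0 ≤ C := (norm_nonneg _).trans (hC 0)
  have hr0 : 0 ≤ A * M ^ α := by positivity
  have := isProbabilityMeasure_target hint
  have hdiff : Differentiable ℝ (step (N := N) k V η) := differentiable_step hk hV η
  have hS : MeasurableSet (sublevel N V K) := by
    refine measurableSet_le (Continuous.measurable ?_) measurable_const
    have := hV.continuous
    fun_prop
  have hr : ∀ x ∈ sublevel N V K, ∀ n ≤ T,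
      (N : ℝ)⁻¹ * ∑ j, ‖gradient V ((step k V η)^[n] x j)‖ ^ 2 ≤ (A * M ^ α) ^ 2 :=
    fun x hx n hn => average_gradient_sq_le hN hα0 hα hpos hgrad
      (average_potential_iterate_le hk hV hpd hB hC hN hη hA hα0 hα hM hpos hgrad hgrow hx hn)
  set c₁ := η * c + η ^ 2 * (N * B ^ 2 * (2 * C * ((A * M ^ α) ^ 2 + d)
          + 48 * d * ((A * M ^ α) ^ 2 + d + C ^ 2))) with hc₁
  have hu : Measurable fun x : Fin N → E d => η * N * ∑ n ∈ Finset.range T, ksdSq k V ((step k V η)^[n] x) := by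
    refine Continuous.measurable (continuous_const.mul (continuous_finsetSum _ fun n _ => ?_))
    exact (continuous_ksdSq hk hV).comp (hdiff.continuous.iterate n)
  refine (setLIntegral_le_klDiv_add hp hS hu (c := T * c₁) (by positivity)).trans ?_
  gcongr
  refine le_trans ?_ (setLIntegral_exp_mul_abs_det_le_one hV.continuous hint hS (hdiff.iterate T)
    (injOn_iterate fun x hx n hn y hxy => eq_of_step_eq hk hV hB hC hN hη hr0
      (hr x hx n hn.le) hinj hxy))
  refine setLIntegral_mono' hS fun x hx => ENNReal.ofReal_le_ofReal ?_
  obtain ⟨hdet, hsum⟩ := sum_le_log_jacobian_iterate hdiff (W := fun x => ∑ i, V (x i))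
    (Q := fun x => η * N * ksdSq k V x - c₁) (x := x) (T := T) fun n hn => by
      obtain ⟨h1, h2⟩ := ksdSq_le_log_jacobian hk hV hB hC hN hη (hr x hx n hn.le) hsmall hc
      refine ⟨h1, ?_⟩
      rw [Function.iterate_succ_apply']
      simp only [hc₁]
      linarith
  rw [← Real.exp_log (abs_pos.mpr hdet), ← Real.exp_add]
  refine Real.exp_le_exp.mpr (le_trans (le_of_eq ?_) hsum)
  rw [Finset.sum_sub_distrib, ← Finset.mul_sum]
  simp

end Trajectory

end SVGD

/-! ### Arithmetic of the step size and the horizon. -/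

namespace SVGD

/-- Consequences of the choice of the step size, in terms of `s = √d`, `ℓ = N ^ (α / (1 - α))`,
`κ = K ^ α` and a bound `q ≤ κ + ℓ`. -/
theorem step_size_scaling {a η d s N ℓ κ q D T : ℝ} (ha : 0 ≤ a) (hη : 0 ≤ η)
    (hηa : η * (D * N * ℓ ^ 2) = a) (hs : 1 ≤ s) (hsd : s ^ 2 = d) (hN : 1 ≤ N) (hℓ : 1 ≤ ℓ)
    (hq0 : 0 ≤ q) (hq : q ≤ κ + ℓ) (hdD : d ≤ D) (hκD : s * κ ≤ D)
    (hT : T ≤ 2 * (N * ℓ) ^ 2) :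
    η ≤ a ∧ η * d ≤ a ∧ η * (s * q) ≤ 2 * a ∧ η * q ≤ 2 * a ∧
    T * η ≤ 2 * a * (N * ℓ) ∧ T * (η * (s * q)) ≤ 4 * a * (N * ℓ) ∧
    N * (η * q ^ 2) ≤ 4 * a * D ∧ N * (η * d) ≤ a * D := by
  have hsdl : s ≤ d := by rw [← hsd, sq]; exact le_mul_of_one_le_left (by linarith) hs
  have hd1 : 1 ≤ d := hs.trans hsdl
  have hD1 : 1 ≤ D := hd1.trans hdD
  have hℓ2 : ℓ ≤ ℓ ^ 2 := by rw [sq]; exact le_mul_of_one_le_left (by linarith) hℓ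
  have hNℓ2 : ℓ ≤ N * ℓ ^ 2 := hℓ2.trans (le_mul_of_one_le_left (by positivity) hN)
  have hDℓ : D ≤ D * ℓ := le_mul_of_one_le_right (by linarith) hℓ
  have hsq : s * q ≤ 2 * (D * ℓ) := by
    calc s * q ≤ s * (κ + ℓ) := by gcongr
      _ = s * κ + s * ℓ := mul_add _ _ _
      _ ≤ D * ℓ + D * ℓ := add_le_add (hκD.trans hDℓ) (by gcongr; exact hsdl.trans hdD)
      _ = _ := by ring
  have hqs : q ≤ s * q := le_mul_of_one_le_left hq0 hs
  have f1 : η * d ≤ a := by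
    rw [← hηa]
    refine mul_le_mul_of_nonneg_left ?_ hη
    calc d ≤ D * 1 := by linarith
      _ ≤ D * (N * ℓ ^ 2) := by gcongr; exact hℓ.trans hNℓ2
      _ = _ := by ring
  have f2 : η * (s * q) ≤ 2 * a := by
    calc η * (s * q) ≤ η * (2 * (D * ℓ)) := by gcongr
      _ ≤ η * (2 * (D * (N * ℓ ^ 2))) := by gcongr
      _ = 2 * (η * (D * N * ℓ ^ 2)) := by ring
      _ = 2 * a := by rw [hηa]
  refine ⟨(le_mul_of_one_le_right hη hd1).trans f1, f1, f2,
    (mul_le_mul_of_nonneg_left hqs hη).trans f2, ?_, ?_, ?_, ?_⟩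
  · calc T * η ≤ 2 * (N * ℓ) ^ 2 * η := by gcongr
      _ = 2 * (N * ℓ) * (η * (1 * N * ℓ)) := by ring
      _ ≤ 2 * (N * ℓ) * (η * (D * N * ℓ ^ 2)) := by gcongr
      _ = _ := by rw [hηa]; ring
  · calc T * (η * (s * q)) ≤ 2 * (N * ℓ) ^ 2 * (η * (2 * (D * ℓ))) := by gcongr
      _ = 4 * (η * (D * N * ℓ ^ 2)) * (N * ℓ) := by ring
      _ = _ := by rw [hηa]
  · calc N * (η * q ^ 2) ≤ N * (η * (2 * (D * ℓ)) ^ 2) := by gcongr; exact hqs.trans hsq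
      _ = 4 * (η * (D * N * ℓ ^ 2)) * D := by ring
      _ = _ := by rw [hηa]
  · calc N * (η * d) ≤ N * (η * (D * ℓ ^ 2)) := by
          gcongr
          exact hdD.trans (le_mul_of_one_le_right (by linarith) (hℓ.trans hℓ2))
      _ = η * (D * N * ℓ ^ 2) * 1 := by ring
      _ ≤ _ := by rw [hηa]; gcongr

/-- The smallness conditions on the step size, and the size of the discretization error. -/
theorem step_size_estimates {A B C a η d s N ℓ q D T : ℝ} (hA : 0 ≤ A) (hB : 0 ≤ B) (hC : 0 ≤ C)
    (ha : a = 1 / (20 * ((1 + A) * (1 + B) * (1 + C)))) (hη : 0 ≤ η) (hs : 1 ≤ s) (hsd : s ^ 2 = d)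
    (hNℓ : 0 ≤ N * ℓ) (hq0 : 0 ≤ q) (hT0 : 0 ≤ T)
    (f0 : η ≤ a) (f1 : η * d ≤ a) (f2 : η * (s * q) ≤ 2 * a) (f3 : η * q ≤ 2 * a)
    (f4 : T * η ≤ 2 * a * (N * ℓ)) (f5 : T * (η * (s * q)) ≤ 4 * a * (N * ℓ))
    (f6 : N * (η * q ^ 2) ≤ 4 * a * D) (f7 : N * (η * d) ≤ a * D) :
    T * (η * (B * s * (A * q)) + η ^ 2 * (2 * C * B ^ 2 * ((A * q) ^ 2 + d))) ≤ N * ℓ ∧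
    η * (2 * B * s * (A * q) + 2 * B * d + B * C) < 1 ∧
    η ^ 2 * (12 * B ^ 2 * (d * (A * q) ^ 2 + d ^ 2 + C ^ 2)) ≤ 1 / 4 ∧
    N * (η * ((A * q) ^ 2 + d)) ≤ (4 * A ^ 2 + 1) * a * D := by
  obtain ⟨m, hm⟩ : ∃ m, m = (1 + A) * (1 + B) * (1 + C) := ⟨_, rfl⟩
  rw [← hm] at ha
  have hm0 : 0 < m := by rw [hm]; positivity
  have ha0 : 0 < a := by rw [ha]; positivity
  have ham : a * m = 1 / 20 := by rw [ha]; field_simp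
  have ham2 : a ^ 2 * m ^ 2 = 1 / 400 := by rw [← mul_pow, ham]; norm_num
  have hd0 : 0 ≤ d := by rw [← hsd]; positivity
  have mABC : A * B * (1 + C) ≤ m := by rw [hm]; gcongr <;> linarith
  have mBC : B * (1 + C) ≤ m := by
    calc B * (1 + C) = 1 * B * (1 + C) := by ring
      _ ≤ _ := by rw [hm]; gcongr <;> linarith
  have hBC : B * C ≤ m := le_trans (by gcongr; linarith) mBC
  have hB1 : B ≤ m := (le_mul_of_one_le_right hB (by linarith)).trans mBC
  have hAB : A * B ≤ m := (le_mul_of_one_le_right (by positivity) (by linarith)).trans mABC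
  have hB2 : B ^ 2 ≤ m ^ 2 := by gcongr
  have hAB2 : A ^ 2 * B ^ 2 ≤ m ^ 2 := by rw [← mul_pow]; gcongr
  have hBC2 : B ^ 2 * C ^ 2 ≤ m ^ 2 := by rw [← mul_pow]; gcongr
  have hC2 : C ≤ (1 + C) ^ 2 := by nlinarith
  have hCB2 : C * B ^ 2 ≤ m ^ 2 := by
    calc C * B ^ 2 ≤ (1 + C) ^ 2 * B ^ 2 := by gcongr
      _ = (B * (1 + C)) ^ 2 := by ring
      _ ≤ _ := by gcongr
  have hCAB2 : C * (A ^ 2 * B ^ 2) ≤ m ^ 2 := by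
    calc C * (A ^ 2 * B ^ 2) ≤ (1 + C) ^ 2 * (A ^ 2 * B ^ 2) := by gcongr
      _ = (A * B * (1 + C)) ^ 2 := by ring
      _ ≤ _ := by gcongr
  have hqs : q ≤ s * q := le_mul_of_one_le_left hq0 hs
  refine ⟨?_, ?_, ?_, ?_⟩
  · have h1 : T * (η * (B * s * (A * q))) ≤ (1 / 5) * (N * ℓ) := by
      calc T * (η * (B * s * (A * q))) = A * B * (T * (η * (s * q))) := by ring
        _ ≤ m * (4 * a * (N * ℓ)) := by gcongr
        _ = 4 * (a * m) * (N * ℓ) := by ring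
        _ = _ := by rw [ham]; ring
    have h2 : T * (η ^ 2 * q ^ 2) ≤ 8 * a ^ 2 * (N * ℓ) := by
      calc T * (η ^ 2 * q ^ 2) = η * q * (T * (η * q)) := by ring
        _ ≤ 2 * a * (T * (η * (s * q))) := by gcongr
        _ ≤ 2 * a * (4 * a * (N * ℓ)) := by gcongr
        _ = _ := by ring
    have h3 : T * (η ^ 2 * d) ≤ 2 * a ^ 2 * (N * ℓ) := by
      calc T * (η ^ 2 * d) = η * d * (T * η) := by ring
        _ ≤ a * (2 * a * (N * ℓ)) := by gcongr
        _ = _ := by ring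
    have h4 : T * (η ^ 2 * (2 * C * B ^ 2 * ((A * q) ^ 2 + d))) ≤ (1 / 20) * (N * ℓ) := by
      calc _ = 2 * (C * (A ^ 2 * B ^ 2)) * (T * (η ^ 2 * q ^ 2))
            + 2 * (C * B ^ 2) * (T * (η ^ 2 * d)) := by ring
        _ ≤ 2 * m ^ 2 * (8 * a ^ 2 * (N * ℓ)) + 2 * m ^ 2 * (2 * a ^ 2 * (N * ℓ)) := by gcongr
        _ = 20 * (a ^ 2 * m ^ 2) * (N * ℓ) := by ring
        _ = _ := by rw [ham2]; ring
    rw [mul_add]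
    linarith
  · calc _ = 2 * (A * B) * (η * (s * q)) + 2 * B * (η * d) + (B * C) * η := by ring
      _ ≤ 2 * m * (2 * a) + 2 * m * a + m * a := by gcongr
      _ = 7 * (a * m) := by ring
      _ < 1 := by rw [ham]; norm_num
  · calc _ = 12 * (A ^ 2 * B ^ 2 * (η * (s * q)) ^ 2 + B ^ 2 * (η * d) ^ 2
          + B ^ 2 * C ^ 2 * η ^ 2) := by rw [← hsd]; ring
      _ ≤ 12 * (m ^ 2 * (2 * a) ^ 2 + m ^ 2 * a ^ 2 + m ^ 2 * a ^ 2) := by gcongr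
      _ = 72 * (a ^ 2 * m ^ 2) := by ring
      _ ≤ 1 / 4 := by rw [ham2]; norm_num
  · calc _ = A ^ 2 * (N * (η * q ^ 2)) + N * (η * d) := by ring
      _ ≤ A ^ 2 * (4 * a * D) + a * D := by gcongr
      _ = _ := by ring

/-- The entropy bound, divided by `η N T`, in the form of the final estimate. -/
theorem entropy_bound_le {A B C a η d N ℓ q D T c E : ℝ} (hC : 0 ≤ C)
    (ha : 0 < a) (hη : 0 < η) (hηa : η * (D * N * ℓ ^ 2) = a) (hd : 1 ≤ d) (hdD : d ≤ D)
    (hN : 1 ≤ N) (hℓ : 1 ≤ ℓ) (hT : (N * ℓ) ^ 2 ≤ T) (hc : 0 ≤ c) (hE : 0 ≤ E)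
    (herr : N * (η * ((A * q) ^ 2 + d)) ≤ (4 * A ^ 2 + 1) * a * D) :
    E * N * d + T * (η * (c * d) + η ^ 2 * (N * B ^ 2 * (2 * C * ((A * q) ^ 2 + d)
          + 48 * d * ((A * q) ^ 2 + d + C ^ 2)))) + 1
      ≤ η * N * T * (((E + 1) / a + c + B ^ 2 * (2 * C + 48 + 48 * C ^ 2) * ((4 * A ^ 2 + 1) * a))
        * (d * D / N)) := by
  have hD : 1 ≤ D := hd.trans hdD
  have hN0 : N ≠ 0 := by positivity
  have hT0 : 0 ≤ T := le_trans (by positivity) hT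
  have h1 : E * N * d + 1 ≤ η * N * T * ((E + 1) / a * (d * D / N)) := by
    have e1 : η * N * T * ((E + 1) / a * (d * D / N)) = (η * D * T / a) * ((E + 1) * d) := by
      field_simp
    -- The total time satisfies `η T ≥ a N / D`, so an initial entropy of order `N d` contributes
    -- order `d D / N` after division by `η N T`.
    have e2 : N ≤ η * D * T / a := by
      rw [le_div_iff₀ ha, ← hηa]
      calc N * (η * (D * N * ℓ ^ 2)) = η * D * (N * ℓ) ^ 2 := by ring
        _ ≤ η * D * T := by gcongr
    rw [e1]
    calc E * N * d + 1 ≤ N * ((E + 1) * d) := by nlinarith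
      _ ≤ _ := by gcongr
  have h2 : T * (η * (c * d)) ≤ η * N * T * (c * (d * D / N)) := by
    have e1 : η * N * T * (c * (d * D / N)) = T * (η * (c * d)) * D := by field_simp
    rw [e1]
    exact le_mul_of_one_le_right (by positivity) hD
  have h3 : T * (η ^ 2 * (N * B ^ 2 * (2 * C * ((A * q) ^ 2 + d)
          + 48 * d * ((A * q) ^ 2 + d + C ^ 2))))
      ≤ η * N * T * (B ^ 2 * (2 * C + 48 + 48 * C ^ 2) * ((4 * A ^ 2 + 1) * a) * (d * D / N)) := by
    have hin : 2 * C * ((A * q) ^ 2 + d) + 48 * d * ((A * q) ^ 2 + d + C ^ 2)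
        ≤ (2 * C + 48 + 48 * C ^ 2) * d * ((A * q) ^ 2 + d) := by
      have hR : 1 ≤ (A * q) ^ 2 + d := by nlinarith [sq_nonneg (A * q)]
      have i1 : 2 * C * ((A * q) ^ 2 + d) ≤ 2 * C * ((A * q) ^ 2 + d) * d :=
        le_mul_of_one_le_right (by positivity) hd
      have i2 : 48 * d * C ^ 2 ≤ 48 * d * C ^ 2 * ((A * q) ^ 2 + d) :=
        le_mul_of_one_le_right (by positivity) hR
      nlinarith
    calc _ ≤ T * (η ^ 2 * (N * B ^ 2 * ((2 * C + 48 + 48 * C ^ 2) * d * ((A * q) ^ 2 + d)))) := by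
          gcongr
      _ = T * η * B ^ 2 * (2 * C + 48 + 48 * C ^ 2) * d * (N * (η * ((A * q) ^ 2 + d))) := by ring
      _ ≤ T * η * B ^ 2 * (2 * C + 48 + 48 * C ^ 2) * d * ((4 * A ^ 2 + 1) * a * D) := by gcongr
      _ = _ := by field_simp
  rw [add_mul, add_mul, mul_add, mul_add, mul_add]
  linarith

theorem avgKSDSq_le {d N : ℕ} {k : E d → E d → ℝ} {V : E d → ℝ} {B : ℝ}
    (hpd : (Matrix.of k).PosSemidef) (hk : ContDiff ℝ 2 fun p : E d × E d => k p.1 p.2)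
    (hB : KernelBoundedBy k B) (η : ℝ) {T : ℕ} (hT : 0 < T) (x : Fin N → E d) :
    avgKSDSq k hpd V η T x ≤
      ENNReal.ofReal ((T : ℝ)⁻¹ * ∑ n ∈ Finset.range T, ksdSq k V ((step k V η)^[n] x)) := by
  rw [avgKSDSq, ENNReal.ofReal_mul (by positivity), ENNReal.ofReal_inv_of_pos (by positivity),
    ENNReal.ofReal_natCast,
    ENNReal.ofReal_sum_of_nonneg fun n _ => (KSD_empirical_sq_le hpd hk hB _).1]
  gcongr with n
  exact (KSD_empirical_sq_le hpd hk hB _).2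

end SVGD

/-! ### Assembly of the estimate and the main theorem. -/

namespace SVGD

/-- The integral is taken under the unconditioned law restricted to the sublevel set: both claims of
the theorem follow from it, and the entropy of the conditioned law is not needed. -/
theorem setLIntegral_average_ksdSq_le {d N : ℕ} (hd : 1 ≤ d) (hN : 1 ≤ N)
    {k : E d → E d → ℝ} (hpd : (Matrix.of k).PosSemidef)
    (hk : ContDiff ℝ 2 fun p : E d × E d => k p.1 p.2) {V : E d → ℝ} (hV : ContDiff ℝ 2 V)
    (hint : Integrable fun x => Real.exp (-V x)) {A B C E₀ α c a K η : ℝ} {T : ℕ}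
    (hB : KernelBoundedBy k B) (hC : ∀ x, ‖hessian V x‖ ≤ C) (hpos : ∀ x, 0 ≤ V x)
    (hA : 0 ≤ A) (hα0 : 0 ≤ α) (hα : α ≤ 1 / 2) (hgrad : ∀ x, ‖gradient V x‖ ≤ A * V x ^ α)
    (hc0 : 0 ≤ c) (hc : ∀ x, Cstar k V x ≤ c * d) (hE : 0 ≤ E₀) (hK : 0 < K)
    (ha : a = 1 / (20 * ((1 + A) * (1 + B) * (1 + C))))
    (hη : η = a / dimFactor d α K * (N : ℝ) ^ (-((1 + α) / (1 - α))))
    (hT : T = ⌈(N : ℝ) ^ (2 / (1 - α))⌉₊)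
    {p : Measure (Fin N → E d)} [IsProbabilityMeasure p]
    (hp : InformationTheory.klDiv p (Measure.pi fun _ => target V)
      ≤ ENNReal.ofReal (E₀ * N * d)) :
    0 < T ∧ ∫⁻ x in sublevel N V K, ENNReal.ofReal
        ((T : ℝ)⁻¹ * ∑ n ∈ Finset.range T, ksdSq k V ((step k V η)^[n] x)) ∂p
      ≤ ENNReal.ofReal (((E₀ + 1) / a + c
        + B ^ 2 * (2 * C + 48 + 48 * C ^ 2) * ((4 * A ^ 2 + 1) * a))
        * (d * dimFactor d α K / N)) := by
  have hB0 : 0 ≤ B := (abs_nonneg _).trans (abs_kernel_le hB 0 0)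
  have hC0 : 0 ≤ C := (norm_nonneg _).trans (hC 0)
  have ha0 : 0 < a := by rw [ha]; positivity
  have hN1 : (1 : ℝ) ≤ N := by exact_mod_cast hN
  have hN0 : (0 : ℝ) < N := by linarith
  have hd1 : (1 : ℝ) ≤ d := by exact_mod_cast hd
  have h1α : 0 < 1 - α := by linarith
  obtain ⟨β, hβ⟩ : ∃ β, β = α / (1 - α) := ⟨_, rfl⟩
  have hβ0 : 0 ≤ β := by rw [hβ]; positivity
  obtain ⟨ℓ, hℓdef⟩ : ∃ ℓ, ℓ = (N : ℝ) ^ β := ⟨_, rfl⟩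
  have hℓ : 1 ≤ ℓ := by rw [hℓdef]; exact Real.one_le_rpow hN1 hβ0
  have hNℓ : (N : ℝ) * ℓ = (N : ℝ) ^ (1 + β) := by
    rw [hℓdef, Real.rpow_add hN0, Real.rpow_one]
  have hNℓ1 : 1 ≤ (N : ℝ) * ℓ := one_le_mul_of_one_le_of_one_le hN1 hℓ
  have hNℓα : ((N : ℝ) * ℓ) ^ α = ℓ := by
    rw [hNℓ, ← Real.rpow_mul hN0.le, hℓdef]
    congr 1
    rw [hβ]; field_simp; ring
  have hNℓ2 : ((N : ℝ) * ℓ) ^ 2 = (N : ℝ) ^ (2 / (1 - α)) := by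
    rw [hNℓ, ← Real.rpow_natCast, ← Real.rpow_mul hN0.le]
    congr 1
    rw [hβ]; push_cast; field_simp; ring
  have hηN : (N : ℝ) ^ (-((1 + α) / (1 - α))) * (N * ℓ ^ 2) = 1 := by
    have e : (N : ℝ) * ℓ ^ 2 = (N : ℝ) ^ ((1 + α) / (1 - α)) := by
      rw [hℓdef, ← Real.rpow_natCast ((N : ℝ) ^ β), ← Real.rpow_mul hN0.le]
      nth_rewrite 1 [← Real.rpow_one (N : ℝ)]
      rw [← Real.rpow_add hN0]
      congr 1
      rw [hβ]; push_cast; field_simp; ring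
    rw [e, ← Real.rpow_add hN0, neg_add_cancel, Real.rpow_zero]
  obtain ⟨D, hD⟩ : ∃ D, D = dimFactor d α K := ⟨_, rfl⟩
  rw [← hD] at hη ⊢
  have hdD : (d : ℝ) ≤ D := by
    rw [hD, dimFactor]
    exact le_add_of_nonneg_left (by positivity)
  have hκD : √(d : ℝ) * K ^ α ≤ D := by
    rw [hD, dimFactor]
    have : (0 : ℝ) ≤ (d : ℝ) ^ ((1 + α) / (2 * (1 - α))) := by positivity
    linarith
  have hD0 : 0 < D := by linarith
  have hη0 : 0 < η := by rw [hη]; positivity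
  have hηa : η * (D * N * ℓ ^ 2) = a := by
    calc η * (D * N * ℓ ^ 2)
        = a / D * D * ((N : ℝ) ^ (-((1 + α) / (1 - α))) * (N * ℓ ^ 2)) := by rw [hη]; ring
      _ = a := by rw [hηN, div_mul_cancel₀ _ hD0.ne', mul_one]
  have hT1 : ((N : ℝ) * ℓ) ^ 2 ≤ T := by rw [hT, hNℓ2]; exact Nat.le_ceil _
  have hNℓsq : 1 ≤ ((N : ℝ) * ℓ) ^ 2 := one_le_pow₀ hNℓ1
  have hT2 : (T : ℝ) ≤ 2 * ((N : ℝ) * ℓ) ^ 2 := by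
    have h := (Nat.ceil_lt_add_one (a := (N : ℝ) ^ (2 / (1 - α))) (by positivity)).le
    rw [← hNℓ2] at h
    rw [hT, ← hNℓ2]
    linarith
  have hTpos : (0 : ℝ) < T := by linarith
  -- The allowed growth `N ℓ = N^{1/(1-α)}` is self-consistent because `(N ℓ)^α = ℓ`. Over `T ≈ (N
  -- ℓ)²` steps of size `a / (D N ℓ²)`, growth at a rate of order `√d M^α ≤ √d (K^α + ℓ) ≤ 2 D ℓ`
  -- totals a small multiple of `N ℓ`.
  set M := K + N * ℓ with hM
  have hM0 : 0 ≤ M := by positivity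
  have hq : M ^ α ≤ K ^ α + ℓ := by
    conv_rhs => rw [← hNℓα]
    exact Real.rpow_add_le_add_rpow hK.le (by positivity) hα0 (by linarith)
  obtain ⟨f0, f1, f2, f3, f4, f5, f6, f7⟩ := step_size_scaling (s := √(d : ℝ)) ha0.le hη0.le hηa
    (Real.one_le_sqrt.mpr hd1) (Real.sq_sqrt (Nat.cast_nonneg d)) hN1 hℓ (by positivity) hq
    hdD hκD hT2
  obtain ⟨g1, g2, g3, g4⟩ := step_size_estimates hA hB0 hC0 ha hη0.le
    (Real.one_le_sqrt.mpr hd1) (Real.sq_sqrt (Nat.cast_nonneg d)) (by linarith)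
    (by positivity) hTpos.le f0 f1 f2 f3 f4 f5 f6 f7
  refine ⟨Nat.cast_pos.mp hTpos, ?_⟩
  have hmain := setLIntegral_sum_ksdSq_le hk hV hpd hB hC hN hη0.le hA hα0 hα hM0 hpos hint hgrad
    (by positivity) hc (K := K) (T := T) (by rw [hM] at g1 ⊢; linarith) g2 g3
    (ne_top_of_le_ne_top ENNReal.ofReal_ne_top hp)
  have hbound := entropy_bound_le (E := E₀) (c := c) (B := B) hC0 ha0 hη0 hηa hd1 hdD hN1 hℓ hT1
    hc0 hE g4
  have hle := hmain.trans (add_le_add_left (add_le_add_left hp _) 1)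
  rw [← ENNReal.ofReal_one, ← ENNReal.ofReal_add (by positivity) (by positivity),
    ← ENNReal.ofReal_add (by positivity) zero_le_one] at hle
  replace hle := hle.trans (ENNReal.ofReal_le_ofReal hbound)
  have hpref : 0 < η * N * T := by positivity
  have e : ∀ x : Fin N → E d, ENNReal.ofReal
        ((T : ℝ)⁻¹ * ∑ n ∈ Finset.range T, ksdSq k V ((step k V η)^[n] x))
      = ENNReal.ofReal (η * N * T)⁻¹ * ENNReal.ofReal
        (η * N * ∑ n ∈ Finset.range T, ksdSq k V ((step k V η)^[n] x)) := by
    intro x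
    rw [← ENNReal.ofReal_mul (by positivity)]
    congr 1
    field_simp
  simp only [e]
  rw [lintegral_const_mul' _ _ ENNReal.ofReal_ne_top]
  refine (mul_le_mul_right hle _).trans_eq ?_
  rw [← ENNReal.ofReal_mul (by positivity), inv_mul_cancel_left₀ hpref.ne']

end SVGD

theorem theorem3p1 (B A α C_V cstar C_KL : ℝ) (hB : 0 < B) (hA : 0 < A)
    (hα : α ∈ Set.Icc (0 : ℝ) (1 / 2)) (hcstar : 0 < cstar) (hC_KL : 0 < C_KL) :
    ∃ a b : ℝ, 0 < a ∧ 0 < b ∧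
      ∀ (d N : ℕ) (_ : 1 ≤ d) (_ : 1 ≤ N)
        (k : SVGD.E d → SVGD.E d → ℝ) (hk : (Matrix.of k).PosSemidef)
        (_ : ContDiff ℝ 2 fun p : SVGD.E d × SVGD.E d => k p.1 p.2)
        (V : SVGD.E d → ℝ) (_ : ContDiff ℝ 2 V)
        (_ : Integrable fun x => Real.exp (-V x))
        (_ : SVGD.KernelBoundedBy k B)
        (_ : ∃ m > 0, ∀ x, m ≤ V x)
        (_ : ∀ x, ‖gradient V x‖ ≤ A * V x ^ α)
        (_ : ∀ x, ‖SVGD.hessian V x‖ ≤ C_V)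
        (_ : ∀ x, SVGD.Cstar k V x ≤ cstar * d)
        (p₀ : Measure (Fin N → SVGD.E d)) (_ : IsProbabilityMeasure p₀)
        (_ : InformationTheory.klDiv p₀ (Measure.pi fun _ => SVGD.target V)
          ≤ ENNReal.ofReal (C_KL * N * d))
        (K : ℝ) (_ : 0 < K) (_ : 1 / 2 ≤ p₀ (SVGD.sublevel N V K))
        (η : ℝ) (_ : η = a / SVGD.dimFactor d α K * (N : ℝ) ^ (-((1 + α) / (1 - α))))
        (T : ℕ) (_ : T = ⌈(N : ℝ) ^ (2 / (1 - α))⌉₊),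
        ∫⁻ x, SVGD.avgKSDSq k hk V η T x ∂(p₀[|SVGD.sublevel N V K])
            ≤ ENNReal.ofReal (b * d * SVGD.dimFactor d α K / N) ∧
        ∀ ε : ℝ, 0 < ε →
          p₀ {x | ENNReal.ofReal (b * d * SVGD.dimFactor d α K / (N * ε))
              < SVGD.avgKSDSq k hk V η T x}
            ≤ ENNReal.ofReal ε + p₀ (SVGD.sublevel N V K)ᶜ := by
  have hα0 : 0 ≤ α := hα.1
  have hα1 : α ≤ 1 / 2 := hα.2
  -- The constants are fixed before any `V` is given, so the sign of `C_V` is not yet known.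
  set C := |C_V|
  set a := 1 / (20 * ((1 + A) * (1 + B) * (1 + C))) with ha
  have ha0 : 0 < a := by positivity
  set b₀ := (C_KL + 1) / a + cstar + B ^ 2 * (2 * C + 48 + 48 * C ^ 2) * ((4 * A ^ 2 + 1) * a)
    with hb₀
  have hb₀pos : 0 < b₀ := by positivity
  -- The factor `2` pays for conditioning on an event of probability at least `1/2`.
  refine ⟨a, 2 * b₀, ha0, by positivity, ?_⟩
  intro d N hd hN k hk hks V hV hint hB' hVm hgrad hhess hcs p₀ hp₀ hkl K hK hhalf η hη T hT
  obtain ⟨m, hm, hVm⟩ := hVm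
  obtain ⟨hTpos, hmain⟩ := SVGD.setLIntegral_average_ksdSq_le hd hN hk hks hV hint hB'
    (fun x => (hhess x).trans (le_abs_self C_V)) (fun x => hm.le.trans (hVm x)) hA.le hα0 hα1
    hgrad hcstar.le hcs hC_KL.le hK ha hη hT hkl
  rw [← hb₀] at hmain
  set D := SVGD.dimFactor d α K with hD
  set S := SVGD.sublevel N V K with hS
  -- This majorant is measurable, so Markov's inequality applies to it without measurability of the
  -- discrepancy, which is a supremum over an infinite family.
  set Y : (Fin N → SVGD.E d) → ℝ≥0∞ := fun x => ENNReal.ofReal ((T : ℝ)⁻¹ *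
    ∑ n ∈ Finset.range T, SVGD.ksdSq k V ((SVGD.step k V η)^[n] x)) with hY
  have hYle : ∀ x, SVGD.avgKSDSq k hk V η T x ≤ Y x :=
    fun x => SVGD.avgKSDSq_le hk hks hB' η hTpos x
  have hYm : Measurable Y := by
    refine (Continuous.measurable (continuous_const.mul
      (continuous_finsetSum _ fun n _ => ?_))).ennreal_ofReal
    exact (SVGD.continuous_ksdSq hks hV).comp
      ((SVGD.differentiable_step hks hV η).continuous.iterate n)
  have hSm : MeasurableSet S := by
    refine measurableSet_le (Continuous.measurable ?_) measurable_const
    have := hV.continuous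
    fun_prop
  have hDpos : 0 < D := by
    have : (0 : ℝ) < d := by exact_mod_cast hd
    rw [hD, SVGD.dimFactor]
    positivity
  have hNpos : (0 : ℝ) < N := by exact_mod_cast hN
  have hdpos : (0 : ℝ) < d := by exact_mod_cast hd
  have hscale : 2 * b₀ * d * D / N = 2 * (b₀ * (d * D / N)) := by ring
  refine ⟨?_, fun ε hε => ?_⟩
  · calc ∫⁻ x, SVGD.avgKSDSq k hk V η T x ∂(p₀[|S])
        ≤ ∫⁻ x, Y x ∂(p₀[|S]) := lintegral_mono hYle
      _ = (p₀ S)⁻¹ * ∫⁻ x in S, Y x ∂p₀ := by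
          rw [ProbabilityTheory.cond, lintegral_smul_measure, smul_eq_mul]
      _ ≤ 2 * ENNReal.ofReal (b₀ * (d * D / N)) := by
          refine mul_le_mul' ?_ hmain
          rw [ENNReal.inv_le_iff_inv_le, ← one_div]
          exact hhalf
      _ = _ := by
          rw [hscale, ENNReal.ofReal_mul zero_le_two, ENNReal.ofReal_ofNat]
  · set t := 2 * b₀ * d * D / (N * ε) with ht
    have htpos : 0 < t := by positivity
    have hsub : {x | ENNReal.ofReal t < SVGD.avgKSDSq k hk V η T x}
        ⊆ ({x | ENNReal.ofReal t ≤ Y x} ∩ S) ∪ Sᶜ := by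
      intro x hx
      by_cases hxS : x ∈ S
      · exact Or.inl ⟨(le_of_lt hx).trans (hYle x), hxS⟩
      · exact Or.inr hxS
    refine (measure_mono hsub).trans ((measure_union_le _ _).trans ?_)
    gcongr
    rw [← Measure.restrict_apply' hSm]
    refine (meas_ge_le_lintegral_div hYm.aemeasurable (ENNReal.ofReal_pos.mpr htpos).ne'
      ENNReal.ofReal_ne_top).trans ?_
    refine ENNReal.div_le_of_le_mul (hmain.trans ?_)
    rw [← ENNReal.ofReal_mul hε.le]
    refine ENNReal.ofReal_le_ofReal ?_
    have e : ε * t = 2 * (b₀ * (d * D / N)) := by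
      rw [ht]; field_simp
    rw [e]
    have : 0 ≤ b₀ * (d * D / N) := by positivity
    linarith
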